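/- Let $n\ge 2$ and $1\le k\le n-1$, let $f$ be a positive smooth function on the unit sphere $S^{n-1}\subset\mathbb R^n$, and let $\Omega_0\subset\mathbb R^n$ be a smooth, strictly convex body (smooth boundary with positive Gauss curvature) containing the origin in its interior, with support function $h_0$. Then there is a constant $C>0$, depending only on $n,k,f,\Omega_0$, such that the following holds for every $\theta>0$. Let $\Omega_t$, $t\in[0,\infty)$, be convex bodies with support functions $h(\cdot,t)$, $h(x,t)=\max\{x\cdot Y: Y\in\Omega_t\}$, which for $t>0$ are smooth, strictly convex and contain the origin in their interior, and which solve $$\frac{\partial h}{\partial t}(x,t)=\log\big(\sigma_k(x,t) f(x)\big)\quad\text{on } S^{n-1}\times(0,\infty),\qquad h(x,0)=\theta h_0(x),$$ where $\sigma_k(x,t)$ is the $k$-th elementary symmetric function of the eigenvalues of $w_{ij}=h_{ij}+h\delta_{ij}$ (second covariant derivatives on $S^{n-1}$ with respect to an orthonormal frame). Here $h$ is smooth on $S^{n-1}\times(0,\infty)$, and $h$ and its spatial derivatives up to order two are continuous on $S^{n-1}\times[0,\infty)$. Let $r(t)$ be the inner radius of $\Omega_t$ (radius of the largest ball contained in it),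 $R(t)$ its outer radius (radius of the smallest ball containing it), and $R_0=\sup\{R(t):t\in(0,\infty)\}\in(0,\infty]$. Then, for all $t\in(0,\infty)$, $$ r(t)\ \ge\ \frac{R(t)^2}{C\,(1+R_0)^{3/2}},$$ where the right-hand side is $0$ if $R_0=\infty$. -/

import Mathlib

open Set Metric Topology
open scoped ContDiff Manifold ENNReal InnerProductSpace

noncomputable section

namespace LogFlow

/-- Euclidean space `ℝⁿ` with `n = m + 1`. -/
abbrev Eu (m : ℕ) : Type := EuclideanSpace ℝ (Fin (m + 1))

/-- The unit sphere `S^m = S^{n-1}` of `ℝⁿ`, with its Mathlib structure of a smooth manifold. -/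
abbrev Sph (m : ℕ) : Type := sphere (0 : Eu m) 1

variable {m : ℕ}

/-- The extension of a function `u` on the sphere to `ℝⁿ` that is constant along the rays from the
origin, `y ↦ u (y / |y|)` (with the irrelevant value `0` at the origin). -/
def radialExt (u : Sph m → ℝ) (y : Eu m) : ℝ :=
  if hy : y = 0 then 0
  else u ⟨‖y‖⁻¹ • y, by simp [norm_smul, inv_mul_cancel₀ (norm_ne_zero_iff.mpr hy)]⟩

/-- The tangent space of the sphere at `x`, the hyperplane `x^⊥` of `ℝⁿ`, with the induced inner
product. -/
abbrev tangent (x : Sph m) : Submodule ℝ (Eu m) := (ℝ ∙ (x : Eu m))ᗮ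

/-- The spherical gradient of `u` at the point `x` of the sphere, as a vector of `ℝⁿ`.
(The extension is constant along rays, so this vector is tangent to the sphere.) -/
def sphGrad (u : Sph m → ℝ) (x : Sph m) : Eu m := gradient (radialExt u) (x : Eu m)

/-- The Euclidean derivative at `x` of the gradient of the extension of `u`. -/
def sphGradDeriv (u : Sph m → ℝ) (x : Sph m) : Eu m →L[ℝ] Eu m :=
  fderiv ℝ (gradient (radialExt u)) (x : Eu m)

/-- The spherical Hessian of `u` at `x`, as the endomorphism `v ↦ ∇_v (grad u)` of the tangent
space. The Levi-Civita connection of the sphere is the tangential part of the Euclidean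
derivative. -/
def sphHess (u : Sph m → ℝ) (x : Sph m) : tangent x →L[ℝ] tangent x :=
  (tangent x).orthogonalProjectionOnto ∘L sphGradDeriv u x ∘L (tangent x).subtypeL

/-- The endomorphism `∇² u + u I` of the tangent space, whose matrix in an orthonormal frame is
`w_{ij} = u_{ij} + u δ_{ij}`. If `u` is the support function of a body, then its eigenvalues at `x`
are the principal radii of curvature at the boundary point with outer normal `x`. -/
def radiiOp (u : Sph m → ℝ) (x : Sph m) : tangent x →L[ℝ] tangent x :=
  sphHess u x + u x • ContinuousLinearMap.id ℝ (tangent x)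

/-- `σ_k (∇² u + u I) (x)`: the `k`-th elementary symmetric function of the eigenvalues of
`∇² u + u I`, listed with multiplicity. -/
def sigmaK (k : ℕ) (u : Sph m → ℝ) (x : Sph m) : ℝ :=
  (LinearMap.charpoly (radiiOp u x : tangent x →ₗ[ℝ] tangent x)).roots.esymm k

/-- The support function `h(Ω, x) = max {x · Y : Y ∈ Ω}` of a compact convex set. -/
def suppFn (Ω : ConvexBody (Eu m)) (x : Sph m) : ℝ :=
  sSup ((fun Y : Eu m => ⟪(x : Eu m), Y⟫_ℝ) '' (Ω : Set (Eu m)))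

/-- All principal radii of curvature of `Ω` are positive: `∇² h + h I` is positive definite at
every point of the sphere. -/
def PosRadii (Ω : ConvexBody (Eu m)) : Prop :=
  ∀ (x : Sph m) (v : tangent x), v ≠ 0 → 0 < ⟪radiiOp (suppFn Ω) x v, v⟫_ℝ

/-- A smooth strictly convex body (its boundary is smooth with positive Gauss curvature), expressed
through the support function: it is smooth and all principal radii of curvature are positive. -/
def SmoothStrictlyConvex (Ω : ConvexBody (Eu m)) : Prop :=
  ContMDiff (𝓡 m) 𝓘(ℝ, ℝ) ∞ (suppFn Ω) ∧ PosRadii Ω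

/-- The inner radius: the largest radius of a ball contained in `Ω`. -/
def innerRadius (Ω : ConvexBody (Eu m)) : ℝ :=
  sSup {ρ : ℝ | 0 ≤ ρ ∧ ∃ c : Eu m, closedBall c ρ ⊆ (Ω : Set (Eu m))}

/-- The outer radius: the smallest radius of a ball containing `Ω`. -/
def outerRadius (Ω : ConvexBody (Eu m)) : ℝ :=
  sInf {ρ : ℝ | 0 ≤ ρ ∧ ∃ c : Eu m, (Ω : Set (Eu m)) ⊆ closedBall c ρ}

/-- `Ω t`, `t ∈ [0, ∞)`, is a smooth, strictly convex solution, containing the origin in its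
interior, of the logarithmic curvature flow
`∂h/∂t = log (σ_k f)` on `S^{n-1} × (0, ∞)`, `Ω 0 = K`, where `h (·, t)` is the support function
of `Ω t`. The solution is smooth for positive times, and takes its initial value in the `C²` sense:
`h` and its spatial derivatives up to order two are continuous up to `t = 0`. -/
structure IsFlow (k : ℕ) (f : Sph m → ℝ) (K : ConvexBody (Eu m))
    (Ω : ℝ → ConvexBody (Eu m)) : Prop where
  init : Ω 0 = K
  origin_mem : ∀ t : ℝ, 0 < t → (0 : Eu m) ∈ interior (Ω t : Set (Eu m))
  posRadii : ∀ t : ℝ, 0 < t → PosRadii (Ω t)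
  smooth : ContMDiffOn ((𝓡 m).prod 𝓘(ℝ, ℝ)) 𝓘(ℝ, ℝ) ∞
    (fun p : Sph m × ℝ => suppFn (Ω p.2) p.1) (univ ×ˢ Ioi 0)
  cont : ContinuousOn (fun p : Sph m × ℝ => suppFn (Ω p.2) p.1) (univ ×ˢ Ici 0)
  cont_grad : ContinuousOn (fun p : Sph m × ℝ => sphGrad (suppFn (Ω p.2)) p.1) (univ ×ˢ Ici 0)
  cont_hess : ContinuousOn (fun p : Sph m × ℝ => sphGradDeriv (suppFn (Ω p.2)) p.1)
    (univ ×ˢ Ici 0)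
  evol : ∀ (x : Sph m) (t : ℝ), 0 < t →
    HasDerivAt (fun s => suppFn (Ω s) x) (Real.log (sigmaK k (suppFn (Ω t)) x * f x)) t

/-- `R₀ = sup {R(t) : t ∈ (0, ∞)} ∈ [0, ∞]`. -/
def supOuterRadius (Ω : ℝ → ConvexBody (Eu m)) : ℝ≥0∞ :=
  ⨆ t ∈ Ioi (0 : ℝ), ENNReal.ofReal (outerRadius (Ω t))

end LogFlow

end

/-! The heart of the proof is the bound `C (1 + R₀)^{3/2}` for the principal radii, with `C`
independent of `θ` (`exists_hessForm_bound`). Each support function is extended to ℝⁿ as a function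
H homogeneous of degree one. On tangent vectors of the sphere the flat Hessian of H is the matrix
w_ij, so the computation uses commuting flat derivatives along the lines x₀ + s e_l; Euler's
identity supplies the curvature terms.

The maximum principle is applied to D²H(ξ,ξ) + (A/2)|DH|² with A = (1 + R₀)^{-1/2}, over the sphere,
the times in [0,t] and all unit vectors ξ of ℝⁿ. At a maximum with positive time the third order
terms cancel. Concavity of log σ_k (`log_esym_le_tangent`, `log_esymm_roots_charpoly_le`) controls
the fourth order terms. The gradient term contributes -A ∑ F_i λ_i², where F is the gradient of log
σ_k at the eigenvalues λ_i, and this is at most -A Λ / m for the largest radius Λ. Since the origin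
lies in Ω_t, both |H| and |DH| are at most 2R₀ on the sphere, while log σ_k grows only like log Λ.
Hence A Λ ≤ C (1 + log Λ)(1 + A R₀) (`max_point_inequality`, `IsFlow.principal_radius_inequality`),
that is, Λ ≤ C (1 + R₀)(1 + log Λ). The exponent 3/2 absorbs the logarithm, and also the term
A|DH|². If the maximum is at time 0, the test function is estimated through θ, and θ ≤ C R₀ because
the initial support function is at most 2R₀.

Convex geometry finishes the proof (`closedBall_midpoint_subset`): when all principal radii are at
most M, a ball of radius d²/(16M) fits around the midpoint of a chord of length d ≤ 4M, and a
longest chord has length at least R(t). -/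

noncomputable section

namespace LogFlow

open scoped Pointwise

variable {m : ℕ}

/-! ### Elementary symmetric functions and concavity of log σ_k on the positive orthant -/

section ElementarySymmetric

variable {ι : Type*}

/-- The `k`-th elementary symmetric function of the family `(a i)`, `i ∈ s`. -/
def esym (s : Finset ι) (k : ℕ) (a : ι → ℝ) : ℝ := ∑ T ∈ s.powersetCard k, ∏ i ∈ T, a i

lemma esym_zero (s : Finset ι) (a : ι → ℝ) : esym s 0 a = 1 := by
  simp [esym]

lemma esym_empty_succ (k : ℕ) (a : ι → ℝ) : esym (∅ : Finset ι) (k + 1) a = 0 := by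
  unfold esym
  rw [Finset.powersetCard_eq_empty.2 (by simp), Finset.sum_empty]

lemma esym_insert [DecidableEq ι] {s : Finset ι} {i : ι} (hi : i ∉ s) (k : ℕ) (a : ι → ℝ) :
    esym (insert i s) (k + 1) a = esym s (k + 1) a + a i * esym s k a := by
  unfold esym
  rw [Finset.powersetCard_succ_insert hi, Finset.sum_union, Finset.sum_image, Finset.mul_sum]
  · congr 1
    refine Finset.sum_congr rfl fun T hT => ?_
    rw [Finset.prod_insert]
    exact fun h => hi ((Finset.mem_powersetCard.1 hT).1 h)
  · intro T hT T' hT' h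
    have hT := fun h => hi ((Finset.mem_powersetCard.1 hT).1 h)
    have hT' := fun h => hi ((Finset.mem_powersetCard.1 hT').1 h)
    rw [← Finset.erase_insert hT, ← Finset.erase_insert hT']
    exact congrArg (fun U => U.erase i) h
  · rw [Finset.disjoint_left]
    intro T hT hT'
    obtain ⟨U, -, rfl⟩ := Finset.mem_image.1 hT'
    exact hi ((Finset.mem_powersetCard.1 hT).1 (Finset.mem_insert_self i U))

lemma esym_erase [DecidableEq ι] {s : Finset ι} {i : ι} (hi : i ∈ s) (k : ℕ) (a : ι → ℝ) :
    esym s (k + 1) a = esym (s.erase i) (k + 1) a + a i * esym (s.erase i) k a := by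
  conv_lhs => rw [← Finset.insert_erase hi]
  exact esym_insert (Finset.notMem_erase i s) k a

lemma esym_nonneg (s : Finset ι) (k : ℕ) {a : ι → ℝ} (ha : ∀ i, 0 < a i) : 0 ≤ esym s k a :=
  Finset.sum_nonneg fun _ _ => Finset.prod_nonneg fun i _ => (ha i).le

lemma esym_pos {s : Finset ι} {k : ℕ} (hk : k ≤ s.card) {a : ι → ℝ} (ha : ∀ i, 0 < a i) :
    0 < esym s k a :=
  Finset.sum_pos (fun _ _ => Finset.prod_pos fun i _ => ha i)
    (Finset.powersetCard_nonempty.2 hk)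

/-- Each product of k + 1 entries is counted once for each of its factors; this is Euler's identity
for σ_{k+1}. -/
lemma sum_mul_esym_erase [DecidableEq ι] (s : Finset ι) (k : ℕ) (a : ι → ℝ) :
    ∑ i ∈ s, a i * esym (s.erase i) k a = (k + 1) * esym s (k + 1) a := by
  induction s using Finset.induction_on generalizing k with
  | empty => simp [esym_empty_succ]
  | insert j t hj ih =>
    rw [Finset.sum_insert hj, Finset.erase_insert hj, esym_insert hj]
    have hne : ∀ i ∈ t, (insert j t).erase i = insert j (t.erase i) := fun i hi =>
      Finset.erase_insert_of_ne fun h => hj (h ▸ hi)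
    have hjt : ∀ i, j ∉ t.erase i := fun i h => hj (Finset.mem_of_mem_erase h)
    cases k with
    | zero =>
      have h0 := ih 0
      simp only [esym_zero] at h0 ⊢
      rw [h0]; push_cast; ring
    | succ k =>
      have : ∑ i ∈ t, a i * esym ((insert j t).erase i) (k + 1) a
          = ∑ i ∈ t, a i * esym (t.erase i) (k + 1) a
            + a j * ∑ i ∈ t, a i * esym (t.erase i) k a := by
        rw [Finset.mul_sum, ← Finset.sum_add_distrib]
        refine Finset.sum_congr rfl fun i hi => ?_
        rw [hne i hi, esym_insert (hjt i)]; ring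
      rw [this, ih, ih]; push_cast; ring

/-- σ_{k+1} is affine in each variable, with slope σ_k of the remaining variables. -/
lemma hasDerivAt_esym [DecidableEq ι] (s : Finset ι) (k : ℕ) (a b : ι → ℝ) :
    HasDerivAt (fun ε : ℝ => esym s (k + 1) (fun i => a i + ε * b i))
      (∑ i ∈ s, b i * esym (s.erase i) k a) 0 := by
  induction s using Finset.induction_on generalizing k with
  | empty => simpa [esym_empty_succ] using hasDerivAt_const (0 : ℝ) (0 : ℝ)
  | insert j t hj ih =>
    rw [Finset.sum_insert hj, Finset.erase_insert hj]
    have hne : ∀ i ∈ t, (insert j t).erase i = insert j (t.erase i) := fun i hi =>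
      Finset.erase_insert_of_ne fun h => hj (h ▸ hi)
    have hjt : ∀ i, j ∉ t.erase i := fun i h => hj (Finset.mem_of_mem_erase h)
    simp only [esym_insert hj]
    have hlin : HasDerivAt (fun ε : ℝ => a j + ε * b j) (b j) 0 := by
      simpa using ((hasDerivAt_id (0 : ℝ)).mul_const (b j)).const_add (a j)
    cases k with
    | zero =>
      simp only [esym_zero] at ih ⊢
      refine ((ih 0).add (hlin.mul_const (1 : ℝ))).congr_deriv ?_
      simp [esym_zero]; ring
    | succ k =>
      have hs : ∑ i ∈ t, b i * esym ((insert j t).erase i) (k + 1) a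
          = ∑ i ∈ t, b i * esym (t.erase i) (k + 1) a
            + a j * ∑ i ∈ t, b i * esym (t.erase i) k a := by
        rw [Finset.mul_sum, ← Finset.sum_add_distrib]
        refine Finset.sum_congr rfl fun i hi => ?_
        rw [hne i hi, esym_insert (hjt i)]; ring
      refine ((ih (k + 1)).add (hlin.mul (ih k))).congr_deriv ?_
      rw [hs]; simp; ring

/-- The parallel sum a p / (p + a) is concave and homogeneous of degree one, hence superadditive;
the defect comes from (a q - b p)². Monotonicity in the second argument then passes from p + q to r.
-/
lemma parallelSum_superadditive {a b p q r : ℝ} (ha : 0 < a) (hb : 0 < b) (hp : 0 ≤ p)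
    (hq : 0 ≤ q) (hr : p + q ≤ r) :
    a * p / (p + a) + b * q / (q + b) ≤ (a + b) * r / (r + (a + b)) := by
  have h1 : a * p / (p + a) + b * q / (q + b) ≤ (a + b) * (p + q) / ((p + q) + (a + b)) := by
    rw [div_add_div _ _ (by positivity) (by positivity), div_le_div_iff₀ (by positivity)
      (by positivity)]
    nlinarith [sq_nonneg (a * q - b * p), mul_nonneg hp hq]
  refine h1.trans ?_
  rw [div_le_div_iff₀ (by positivity) (by linarith)]
  nlinarith [mul_pos ha hb, mul_nonneg (sq_nonneg (a + b)) (sub_nonneg.2 hr)]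

/-- The quotients of consecutive elementary symmetric functions are superadditive on the positive
orthant (Marcus and Lopes). -/
lemma esym_quotient_superadditive [DecidableEq ι] (k : ℕ) (s : Finset ι) (hk : k ≤ s.card) {a b : ι → ℝ}
    (ha : ∀ i, 0 < a i) (hb : ∀ i, 0 < b i) :
    esym s (k + 1) a / esym s k a + esym s (k + 1) b / esym s k b
      ≤ esym s (k + 1) (a + b) / esym s k (a + b) := by
  induction k generalizing s with
  | zero =>
    have h := fun c : ι → ℝ => sum_mul_esym_erase s 0 c
    simp only [esym_zero, Nat.cast_zero, zero_add, one_mul, mul_one] at h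
    simp [esym_zero, ← h, Finset.sum_add_distrib]
  | succ k ih =>
    have hab : ∀ i, 0 < (a + b) i := fun i => add_pos (ha i) (hb i)
    -- Splitting σ_{k+1} at the index i writes the quotient as a sum of parallel sums of c_i with
    -- the quotient one degree lower on the other indices. The induction hypothesis applies to the
    -- latter.
    have hterm : ∀ {c : ι → ℝ}, (∀ i, 0 < c i) →
        ((k + 2 : ℕ) : ℝ) * (esym s (k + 2) c / esym s (k + 1) c)
          = ∑ i ∈ s, c i * (esym (s.erase i) (k + 1) c / esym (s.erase i) k c)
              / (esym (s.erase i) (k + 1) c / esym (s.erase i) k c + c i) := by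
      intro c hc
      have h := sum_mul_esym_erase s (k + 1) c
      rw [← mul_div_assoc]
      push_cast at h ⊢
      rw [show (k : ℝ) + 2 = k + 1 + 1 by ring, ← h, Finset.sum_div]
      refine Finset.sum_congr rfl fun i hi => ?_
      have hcard : k ≤ (s.erase i).card := by rw [Finset.card_erase_of_mem hi]; omega
      have hpos := esym_pos hcard hc
      have hpos' := esym_pos hk hc
      have hn := esym_nonneg (s.erase i) (k + 1) hc
      have hci := hc i
      rw [esym_erase hi] at hpos' ⊢
      rw [div_add' _ _ _ hpos.ne']
      field_simp
    have hk2 : (0 : ℝ) < ((k + 2 : ℕ) : ℝ) := by positivity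
    refine le_of_mul_le_mul_left ?_ hk2
    rw [mul_add, hterm ha, hterm hb, hterm hab, ← Finset.sum_add_distrib]
    refine Finset.sum_le_sum fun i hi => ?_
    have hcard : k ≤ (s.erase i).card := by rw [Finset.card_erase_of_mem hi]; omega
    exact parallelSum_superadditive (ha i) (hb i)
      (div_nonneg (esym_nonneg _ _ ha) (esym_nonneg _ _ ha))
      (div_nonneg (esym_nonneg _ _ hb) (esym_nonneg _ _ hb)) (ih _ hcard)

lemma esym_smul (s : Finset ι) (k : ℕ) (c : ℝ) (a : ι → ℝ) :
    esym s k (fun i => c * a i) = c ^ k * esym s k a := by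
  unfold esym
  rw [Finset.mul_sum]
  refine Finset.sum_congr rfl fun T hT => ?_
  rw [Finset.prod_mul_distrib, Finset.prod_const, (Finset.mem_powersetCard.1 hT).2]

/-- Difference quotients from the right. This converts superadditivity of a function of degree one
into a lower bound for its directional derivative. -/
lemma le_deriv_of_forall_pos_le {g : ℝ → ℝ} {g' c : ℝ} (hg : HasDerivAt g g' 0)
    (h : ∀ ε, 0 < ε → g 0 + ε * c ≤ g ε) : c ≤ g' := by
  refine ge_of_tendsto hg.tendsto_slope_zero_right ?_
  filter_upwards [self_mem_nhdsWithin] with ε hε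
  have hε : 0 < ε := hε
  have := h ε hε
  rw [zero_add, smul_eq_mul, ← div_eq_inv_mul, le_div_iff₀ hε]
  linarith

/-- The tangent plane inequality for the concave function `log σ_k` on the positive orthant. -/
lemma log_esym_le_tangent [DecidableEq ι] (k : ℕ) (s : Finset ι) (hk : k + 1 ≤ s.card) {a b : ι → ℝ}
    (ha : ∀ i, 0 < a i) (hb : ∀ i, 0 < b i) :
    Real.log (esym s (k + 1) b) ≤ Real.log (esym s (k + 1) a)
      + (∑ i ∈ s, b i * esym (s.erase i) k a) / esym s (k + 1) a - (k + 1) := by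
  induction k with
  | zero =>
    have hpa := esym_pos hk ha
    have hpb := esym_pos hk hb
    have h := sum_mul_esym_erase s 0 b
    simp only [esym_zero, Nat.cast_zero, zero_add, one_mul, mul_one] at h hpa hpb ⊢
    rw [h]
    have := Real.log_le_sub_one_of_pos (div_pos hpb hpa)
    rw [Real.log_div hpb.ne' hpa.ne'] at this
    linarith
  | succ k ih =>
    have ih := ih (by omega)
    have hpa := esym_pos hk ha
    have hpb := esym_pos hk hb
    have hpa' := esym_pos (s := s) (k := k + 1) (by omega) ha
    have hpb' := esym_pos (s := s) (k := k + 1) (by omega) hb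
    set D1 := ∑ i ∈ s, b i * esym (s.erase i) k a
    set D2 := ∑ i ∈ s, b i * esym (s.erase i) (k + 1) a
    have hd1 := hasDerivAt_esym s k a b
    have hd2 := hasDerivAt_esym s (k + 1) a b
    have hq := hd2.div hd1 (by simpa using hpa'.ne')
    -- The quotient q = σ_{k+2}/σ_{k+1} has degree one, so superadditivity reads q(a + εb) ≥ q(a) +
    -- ε q(b).
    have hle := le_deriv_of_forall_pos_le (c := esym s (k + 2) b / esym s (k + 1) b) hq (by
      intro ε hε
      have := esym_quotient_superadditive (k + 1) s (by omega) ha (b := fun i => ε * b i)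
        (fun i => mul_pos hε (hb i))
      rw [esym_smul, esym_smul] at this
      have hε' : ε * (esym s (k + 2) b / esym s (k + 1) b)
          = ε ^ (k + 1 + 1) * esym s (k + 1 + 1) b / (ε ^ (k + 1) * esym s (k + 1) b) := by
        rw [pow_succ ε (k + 1)]
        field_simp
      rw [hε']
      simpa [Pi.add_def] using this)
    simp only [zero_mul, add_zero] at hle
    change _ ≤ (D2 * _ - _ * D1) / _ at hle
    set A1 := esym s (k + 1) a
    set A2 := esym s (k + 2) a
    set B1 := esym s (k + 1) b
    set B2 := esym s (k + 2) b
    -- The right side is the logarithmic derivative of the quotient at a in the direction b. With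
    -- log x ≤ x - 1 at the ratio of the two quotients, it adds exactly the increment needed to the
    -- inequality one degree lower.
    have h3 : B2 / B1 / (A2 / A1) ≤ D2 / A2 - D1 / A1 := by
      have : D2 / A2 - D1 / A1 = ((D2 * A1 - A2 * D1) / A1 ^ 2) / (A2 / A1) := by
        field_simp
      rw [this]
      exact div_le_div_of_nonneg_right hle (by positivity)
    have h4 := Real.log_le_sub_one_of_pos (x := B2 / B1 / (A2 / A1)) (by positivity)
    rw [Real.log_div (by positivity) (by positivity), Real.log_div (by positivity) (by positivity),
      Real.log_div (by positivity) (by positivity)] at h4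
    change Real.log B2 ≤ Real.log A2 + D2 / A2 - _
    push_cast
    linarith

/-- The term of the largest entry is at least the average of the terms of `sum_mul_esym_erase`. -/
lemma esym_le_card_mul_max [DecidableEq ι] (s : Finset ι) (k : ℕ) {a : ι → ℝ} (ha : ∀ i, 0 < a i) {j : ι}
    (hj : j ∈ s) (hmax : ∀ i ∈ s, a i ≤ a j) :
    (k + 1) * esym s (k + 1) a ≤ s.card * (a j * esym (s.erase j) k a) := by
  rw [← sum_mul_esym_erase, ← nsmul_eq_mul]
  refine Finset.sum_le_card_nsmul _ _ _ fun i hi => ?_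
  rcases eq_or_ne i j with rfl | hij
  · exact le_rfl
  cases k with
  | zero => simpa [esym_zero] using hmax i hi
  | succ k =>
    -- After splitting each side at the other index, the part containing a_i a_j is common to both;
    -- what is left is a_i, respectively a_j, times the same nonnegative factor.
    rw [esym_erase (Finset.mem_erase.2 ⟨hij, hi⟩), esym_erase (Finset.mem_erase.2 ⟨hij.symm, hj⟩),
      Finset.erase_right_comm]
    have := mul_le_mul_of_nonneg_right (hmax i hi)
      (esym_nonneg ((s.erase j).erase i) (k + 1) ha)
    nlinarith

lemma esym_le_choose_mul_pow (s : Finset ι) (k : ℕ) {a : ι → ℝ} (ha : ∀ i, 0 < a i) {M : ℝ}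
    (hM : ∀ i, a i ≤ M) : esym s k a ≤ s.card.choose k * M ^ k := by
  rw [← Finset.card_powersetCard, ← nsmul_eq_mul]
  refine Finset.sum_le_card_nsmul _ _ _ fun T hT => ?_
  rw [← (Finset.mem_powersetCard.1 hT).2]
  exact (Finset.prod_le_prod (fun i _ => (ha i).le) fun i _ => hM i).trans_eq
    (Finset.prod_const M)

end ElementarySymmetric

/-! ### The tangent plane inequality for log σ_k of a symmetric operator -/

section Operators

variable {V : Type*} [NormedAddCommGroup V] [InnerProductSpace ℝ V] [FiniteDimensional ℝ V]

lemma esymm_roots_charpoly {T : V →ₗ[ℝ] V} (hT : T.IsSymmetric) {n : ℕ}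
    (hn : Module.finrank ℝ V = n) (k : ℕ) :
    T.charpoly.roots.esymm k = esym Finset.univ k (hT.eigenvalues hn) := by
  rw [hT.roots_charpoly_eq_eigenvalues hn]
  simp only [RCLike.ofReal_real_eq_id, Function.id_comp]
  exact Finset.esymm_map_val _ _ _

lemma eigenvalues_pos {T : V →ₗ[ℝ] V} (hT : T.IsSymmetric) {n : ℕ}
    (hn : Module.finrank ℝ V = n) (hpos : ∀ v, v ≠ 0 → 0 < ⟪T v, v⟫_ℝ) (i : Fin n) :
    0 < hT.eigenvalues hn i := by
  have h := hpos (hT.eigenvectorBasis hn i) ((hT.eigenvectorBasis hn).orthonormal.ne_zero i)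
  rw [hT.apply_eigenvectorBasis, inner_smul_left] at h
  simpa using h

/-- The tangent plane inequality for `log σ_k` on positive definite operators, at an operator with
eigenvalues `a`; the linear functional is evaluated on the diagonal entries of `T` in an arbitrary
orthonormal basis `v`. -/
lemma log_esymm_roots_charpoly_le {T : V →ₗ[ℝ] V} (hT : T.IsSymmetric) {n : ℕ}
    (hn : Module.finrank ℝ V = n) (hpos : ∀ v, v ≠ 0 → 0 < ⟪T v, v⟫_ℝ) {k : ℕ} (hk : k + 1 ≤ n)
    {a : Fin n → ℝ} (ha : ∀ i, 0 < a i) (v : OrthonormalBasis (Fin n) ℝ V) :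
    Real.log (T.charpoly.roots.esymm (k + 1)) ≤ Real.log (esym Finset.univ (k + 1) a)
      + (∑ i, ⟪T (v i), v i⟫_ℝ * esym (Finset.univ.erase i) k a) / esym Finset.univ (k + 1) a
      - (k + 1) := by
  classical
  set μ := hT.eigenvalues hn with hμ
  set u := hT.eigenvectorBasis hn with hu
  have hμpos : ∀ i, 0 < μ i := eigenvalues_pos hT hn hpos
  -- The diagonal entries are averages of the eigenvalues with the doubly stochastic weights ⟪v i, u
  -- j⟫². By Birkhoff's theorem they form a convex combination of permuted eigenvalue vectors. All
  -- of these have the same σ_{k+1}, so the vector inequality can be averaged over the permutations.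
  have hdiag : ∀ i, ⟪T (v i), v i⟫_ℝ = ∑ j, ⟪v i, u j⟫_ℝ ^ 2 * μ j := by
    intro i
    rw [← u.sum_inner_mul_inner]
    refine Finset.sum_congr rfl fun j _ => ?_
    rw [hT, hT.apply_eigenvectorBasis, inner_smul_right, real_inner_comm (v i) (u j)]
    simp only [RCLike.ofReal_real_eq_id, id, ← hμ, ← hu]
    ring
  let D : Matrix (Fin n) (Fin n) ℝ := fun i j => ⟪v i, u j⟫_ℝ ^ 2
  have hD : D ∈ doublyStochastic ℝ (Fin n) := by
    rw [mem_doublyStochastic_iff_sum]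
    refine ⟨fun i j => sq_nonneg _, fun i => ?_, fun j => ?_⟩
    · have := u.sum_sq_norm_inner_left (v i)
      simpa [D] using this
    · have := v.sum_sq_norm_inner_right (u j)
      simpa [D] using this
  obtain ⟨w, hw0, hw1, hwD⟩ := exists_eq_sum_perm_of_mem_doublyStochastic hD
  have hDv : ∀ i, ∑ j, D i j * μ j = ∑ σ : Equiv.Perm (Fin n), w σ * μ (σ i) := by
    intro i
    have : ∀ j, D i j = ∑ σ : Equiv.Perm (Fin n), w σ * (if σ i = j then 1 else 0) := by
      intro j
      rw [← hwD, Matrix.sum_apply]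
      refine Finset.sum_congr rfl fun σ _ => ?_
      simp [PEquiv.toMatrix_apply, Equiv.toPEquiv_apply, eq_comm]
    simp_rw [this, Finset.sum_mul]
    rw [Finset.sum_comm]
    simp
  have hperm : ∀ σ : Equiv.Perm (Fin n),
      esym Finset.univ (k + 1) (fun i => μ (σ i)) = esym Finset.univ (k + 1) μ := by
    intro σ
    have h1 := (Finset.esymm_map_val (fun i => μ (σ i)) Finset.univ (k + 1)).symm
    have h2 := (Finset.esymm_map_val μ Finset.univ (k + 1)).symm
    unfold esym
    rw [h1, h2]
    congr 1
    have : (Finset.univ : Finset (Fin n)).val.map (fun i => μ (σ i))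
        = (((Finset.univ : Finset (Fin n)).map σ.toEmbedding).val).map μ := by
      rw [Finset.map_val, Multiset.map_map]; rfl
    rw [this, Finset.map_univ_equiv]
  rw [esymm_roots_charpoly hT hn (k + 1), ← hμ]
  have hmain := fun σ : Equiv.Perm (Fin n) => log_esym_le_tangent k Finset.univ (by simpa using hk) ha
    (b := fun i => μ (σ i)) (fun i => hμpos _)
  simp only [hperm] at hmain
  set c := esym Finset.univ (k + 1) a
  have hsum : ∑ σ, w σ * Real.log (esym Finset.univ (k + 1) μ) ≤ ∑ σ, w σ * (Real.log c
      + (∑ i, μ (σ i) * esym (Finset.univ.erase i) k a) / c - (k + 1)) :=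
    Finset.sum_le_sum fun σ _ => mul_le_mul_of_nonneg_left (hmain σ) (hw0 σ)
  rw [← Finset.sum_mul, hw1, one_mul] at hsum
  refine hsum.trans_eq ?_
  simp only [mul_sub, mul_add, Finset.sum_sub_distrib, Finset.sum_add_distrib, ← Finset.sum_mul, hw1,
    one_mul]
  congr 2
  simp_rw [hdiag]
  change _ = (∑ i, (∑ j, D i j * μ j) * _) / c
  simp_rw [hDv, Finset.sum_mul, mul_div_assoc', ← Finset.sum_div]
  congr 1
  rw [Finset.sum_comm]
  simp_rw [Finset.mul_sum, mul_assoc]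

end Operators

/-! ### Commuting directional derivatives -/

section DirectionalDerivative

variable {F : Type*} [NormedAddCommGroup F] [NormedSpace ℝ F]

/-- The derivative of `G` at `p` in the direction `v`. -/
def dd (v : F) (G : F → ℝ) (p : F) : ℝ := fderiv ℝ G p v

lemma contDiffOn_dd {G : F → ℝ} {U : Set F} (hU : IsOpen U) (hG : ContDiffOn ℝ ∞ G U) (v : F) :
    ContDiffOn ℝ ∞ (dd v G) U :=
  (hG.fderiv_of_isOpen hU (m := ∞) (by simp)).clm_apply contDiffOn_const

lemma differentiableAt_of_contDiffOn {G : F → ℝ} {U : Set F} (hU : IsOpen U)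
    (hG : ContDiffOn ℝ ∞ G U) {p : F} (hp : p ∈ U) : DifferentiableAt ℝ G p :=
  (hG.contDiffAt (hU.mem_nhds hp)).differentiableAt (by simp)

lemma dd_comm {G : F → ℝ} {U : Set F} (hU : IsOpen U) (hG : ContDiffOn ℝ ∞ G U) {p : F}
    (hp : p ∈ U) (v w : F) : dd v (dd w G) p = dd w (dd v G) p := by
  have hd : DifferentiableAt ℝ (fderiv ℝ G) p :=
    ((hG.fderiv_of_isOpen hU (m := ∞) (by simp)).contDiffAt (hU.mem_nhds hp)).differentiableAt
      (by simp)
  have h : ∀ v w : F, dd v (dd w G) p = fderiv ℝ (fderiv ℝ G) p v w := by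
    intro v w
    change fderiv ℝ (fun q => fderiv ℝ G q w) p v = _
    rw [fderiv_clm_apply hd (differentiableAt_const w)]
    simp
  rw [h, h]
  exact ((hG.contDiffAt (hU.mem_nhds hp)).isSymmSndFDerivAt
    (by rw [minSmoothness_of_isRCLikeNormedField]; exact WithTop.coe_le_coe.2 le_top)) v w

lemma dd_congr {G G' : F → ℝ} {U : Set F} (hU : IsOpen U) (h : EqOn G G' U) {p : F}
    (hp : p ∈ U) (v : F) : dd v G p = dd v G' p := by
  unfold dd
  rw [(h.eventuallyEq_of_mem (hU.mem_nhds hp)).fderiv_eq]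

lemma dd_add_dir (v w : F) (G : F → ℝ) (p : F) : dd (v + w) G p = dd v G p + dd w G p := by
  simp [dd]

lemma dd_smul_dir (c : ℝ) (v : F) (G : F → ℝ) (p : F) : dd (c • v) G p = c * dd v G p := by
  simp [dd]

lemma hasDerivAt_line {G : F → ℝ} {p v : F} {s : ℝ} (hG : DifferentiableAt ℝ G (p + s • v)) :
    HasDerivAt (fun s : ℝ => G (p + s • v)) (dd v G (p + s • v)) s := by
  have hl : HasDerivAt (fun s : ℝ => p + s • v) v s := by
    simpa using ((hasDerivAt_id s).smul_const v).const_add p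
  exact hG.hasFDerivAt.comp_hasDerivAt s hl

lemma hasDerivAt_line_zero {G : F → ℝ} {p v : F} (hG : DifferentiableAt ℝ G p) :
    HasDerivAt (fun s : ℝ => G (p + s • v)) (dd v G p) 0 := by
  have := hasDerivAt_line (G := G) (p := p) (v := v) (s := 0) (by simpa using hG)
  simpa using this

end DirectionalDerivative

/-! ### Derivative tests at a maximum -/

/-- If the second derivative were positive, the point would also be a local minimum; the function
would then be locally constant, with vanishing second derivative. -/
lemma secondDeriv_nonpos_of_isLocalMax {ψ ψ₁ : ℝ → ℝ} {ψ₂ : ℝ} (hmax : IsLocalMax ψ 0)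
    (h1 : ∀ᶠ s in 𝓝 0, HasDerivAt ψ (ψ₁ s) s) (h2 : HasDerivAt ψ₁ ψ₂ 0) :
    ψ₁ 0 = 0 ∧ ψ₂ ≤ 0 := by
  have h10 : ψ₁ 0 = 0 := hmax.hasDerivAt_eq_zero h1.self_of_nhds
  refine ⟨h10, ?_⟩
  by_contra! hpos
  have hde : deriv ψ =ᶠ[𝓝 0] ψ₁ := h1.mono fun s hs => hs.deriv
  have hdd : deriv (deriv ψ) 0 = ψ₂ := by rw [hde.deriv_eq, h2.deriv]
  have hmin := isLocalMin_of_deriv_deriv_pos (f := ψ) (x₀ := 0) (by rw [hdd]; exact hpos)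
    (by rw [hde.self_of_nhds, h10]) h1.self_of_nhds.continuousAt
  have hconst : ψ =ᶠ[𝓝 0] fun _ => ψ 0 := by
    filter_upwards [hmax, hmin] with s hs hs' using le_antisymm hs hs'
  have : deriv (deriv ψ) 0 = 0 := by
    rw [(hconst.deriv).deriv_eq]; simp
  linarith

/-- Only earlier times are compared, since the maximum may occur at the final time. -/
lemma deriv_nonneg_of_forall_le {g : ℝ → ℝ} {g' t : ℝ} (ht : 0 < t) (hg : HasDerivAt g g' t)
    (h : ∀ s, 0 < s → s ≤ t → g s ≤ g t) : 0 ≤ g' := by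
  refine ge_of_tendsto hg.tendsto_slope_zero_left ?_
  have : Ioo (-t) 0 ∈ 𝓝[<] (0 : ℝ) := Ioo_mem_nhdsLT (by linarith)
  filter_upwards [this] with ε hε
  have := h (t + ε) (by linarith [hε.1]) (by linarith [hε.2])
  exact mul_nonneg_of_nonpos_of_nonpos (inv_nonpos.2 hε.2.le) (by linarith)

/-! ### Homogeneous functions and Euler's identity -/

section Homogeneity

variable {E : Type*} [NormedAddCommGroup E]

/-- The open set of space-time points away from the origin and at positive times. -/
def punctured (E : Type*) [NormedAddCommGroup E] : Set (E × ℝ) := {p | p.1 ≠ 0 ∧ 0 < p.2}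

lemma isOpen_punctured : IsOpen (punctured E) :=
  (isOpen_ne.preimage continuous_fst).inter (isOpen_Ioi.preimage continuous_snd)

variable [NormedSpace ℝ E]

/-- Positive homogeneity of degree `d` in the space variable. -/
def IsHom (d : ℤ) (G : E × ℝ → ℝ) : Prop :=
  ∀ c : ℝ, 0 < c → ∀ (y : E) (t : ℝ), y ≠ 0 → 0 < t → G (c • y, t) = c ^ d * G (y, t)

lemma IsHom.dd_space {d : ℤ} {G : E × ℝ → ℝ} (hG : ContDiffOn ℝ ∞ G (punctured E))
    (h : IsHom d G) (v : E) : IsHom (d - 1) (dd (v, (0 : ℝ)) G) := by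
  intro c hc y t hy ht
  have hcy : (c • y, t) ∈ punctured E := ⟨smul_ne_zero hc.ne' hy, ht⟩
  have hyt : (y, t) ∈ punctured E := ⟨hy, ht⟩
  have h1 := hasDerivAt_line_zero (v := (c • v, (0 : ℝ)))
    (differentiableAt_of_contDiffOn isOpen_punctured hG hcy)
  have h2 := (hasDerivAt_line_zero (v := (v, (0 : ℝ)))
    (differentiableAt_of_contDiffOn isOpen_punctured hG hyt)).const_mul (c ^ d)
  have hev : (fun s : ℝ => G ((c • y, t) + s • (c • v, (0 : ℝ))))
      =ᶠ[𝓝 0] fun s : ℝ => c ^ d * G ((y, t) + s • (v, (0 : ℝ))) := by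
    have hcont : Continuous fun s : ℝ => y + s • v := by fun_prop
    have : ∀ᶠ s in 𝓝 (0 : ℝ), y + s • v ≠ 0 :=
      hcont.continuousAt.eventually_ne (by simpa using hy)
    filter_upwards [this] with s hs
    have := h c hc (y + s • v) t hs ht
    simpa [smul_add, smul_comm s c v] using this
  have := h1.unique (h2.congr_of_eventuallyEq hev)
  rw [show ((c • v, (0 : ℝ)) : E × ℝ) = c • (v, (0 : ℝ)) by simp, dd_smul_dir] at this
  rw [zpow_sub_one₀ hc.ne']
  field_simp
  linarith

lemma IsHom.dd_time {d : ℤ} {G : E × ℝ → ℝ} (hG : ContDiffOn ℝ ∞ G (punctured E))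
    (h : IsHom d G) : IsHom d (dd ((0 : E), (1 : ℝ)) G) := by
  intro c hc y t hy ht
  have hcy : (c • y, t) ∈ punctured E := ⟨smul_ne_zero hc.ne' hy, ht⟩
  have hyt : (y, t) ∈ punctured E := ⟨hy, ht⟩
  have h1 := hasDerivAt_line_zero (v := ((0 : E), (1 : ℝ)))
    (differentiableAt_of_contDiffOn isOpen_punctured hG hcy)
  have h2 := (hasDerivAt_line_zero (v := ((0 : E), (1 : ℝ)))
    (differentiableAt_of_contDiffOn isOpen_punctured hG hyt)).const_mul (c ^ d)
  refine h1.unique (h2.congr_of_eventuallyEq ?_)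
  filter_upwards [lt_mem_nhds (show -t < 0 by linarith)] with s hs
  have := h c hc y (t + s) hy (by linarith)
  simpa using this

lemma IsHom.euler {d : ℤ} {G : E × ℝ → ℝ} (hG : ContDiffOn ℝ ∞ G (punctured E))
    (h : IsHom d G) {y : E} {t : ℝ} (hy : y ≠ 0) (ht : 0 < t) :
    dd (y, (0 : ℝ)) G (y, t) = d * G (y, t) := by
  have hyt : (y, t) ∈ punctured E := ⟨hy, ht⟩
  have h1 := hasDerivAt_line_zero (v := (y, (0 : ℝ)))
    (differentiableAt_of_contDiffOn isOpen_punctured hG hyt)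
  have h2 : HasDerivAt (fun s : ℝ => (1 + s) ^ d * G (y, t)) (d * G (y, t)) 0 := by
    have hz := hasDerivAt_zpow d (1 + (0 : ℝ)) (by norm_num)
    have hl : HasDerivAt (fun s : ℝ => 1 + s) 1 0 := (hasDerivAt_id (0 : ℝ)).const_add 1
    have := (hz.comp (0 : ℝ) hl).mul_const (G (y, t))
    simpa [Function.comp_def] using this
  refine h1.unique (h2.congr_of_eventuallyEq ?_)
  filter_upwards [lt_mem_nhds (show (-1 : ℝ) < 0 by norm_num)] with s hs
  have := h (1 + s) (by linarith) y t hy ht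
  rw [← this]
  simp [add_smul]

lemma dd_slice {G : E × ℝ → ℝ} (hG : ContDiffOn ℝ ∞ G (punctured E)) {y : E} {t : ℝ}
    (hy : y ≠ 0) (ht : 0 < t) (v : E) :
    dd (v, (0 : ℝ)) G (y, t) = dd v (fun z => G (z, t)) y := by
  have hyt : (y, t) ∈ punctured E := ⟨hy, ht⟩
  have hd := differentiableAt_of_contDiffOn isOpen_punctured hG hyt
  have h1 := hasDerivAt_line_zero (v := (v, (0 : ℝ))) hd
  have hd' : DifferentiableAt ℝ (fun z => G (z, t)) y :=
    hd.comp y (differentiableAt_id.prodMk (differentiableAt_const t))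
  have h2 := hasDerivAt_line_zero (v := v) hd'
  refine h1.unique (h2.congr_of_eventuallyEq (Filter.Eventually.of_forall fun s => ?_))
  simp

end Homogeneity

/-! ### Second order comparison along a line -/

/-- The difference of the two sides is maximal at s = 0. The factor 1 + s² adds 2 N 0 to the second
derivative, and the last term, of order s², is seen only there. -/
lemma derivs_of_touching_above {u φ N L u₁ φ₁ N₁ L₁ : ℝ → ℝ} {u₂ φ₂ N₂ L₂ c d a : ℝ}
    (hu : ∀ s, HasDerivAt u (u₁ s) s) (hu₁ : HasDerivAt u₁ u₂ 0)
    (hφ : ∀ s, HasDerivAt φ (φ₁ s) s) (hφ₁ : HasDerivAt φ₁ φ₂ 0)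
    (hN : ∀ s, HasDerivAt N (N₁ s) s) (hN₁ : HasDerivAt N₁ N₂ 0)
    (hL : ∀ s, HasDerivAt L (L₁ s) s) (hL₁ : HasDerivAt L₁ L₂ 0)
    (hle : ∀ s, u s ≤ c + d * s ^ 2 / 2 + φ s + (1 + s ^ 2) * N s
      + s ^ 2 * (1 + s ^ 2) * (a * L s))
    (heq : u 0 = c + φ 0 + N 0) :
    u₁ 0 = φ₁ 0 + N₁ 0 ∧ u₂ ≤ φ₂ + d + 2 * N 0 + N₂ + 2 * (a * L 0) := by
  let ψ : ℝ → ℝ := fun s => u s - (c + d * s ^ 2 / 2 + φ s + (1 + s ^ 2) * N s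
      + (s ^ 2 + s ^ 4) * (a * L s))
  let ψ₁ : ℝ → ℝ := fun s => u₁ s - (d * s + φ₁ s + ((2 * s) * N s + (1 + s ^ 2) * N₁ s)
      + ((2 * s + 4 * s ^ 3) * (a * L s) + (s ^ 2 + s ^ 4) * (a * L₁ s)))
  have hid := fun s : ℝ => hasDerivAt_id s
  have h2 := fun s : ℝ => (hid s).pow 2
  have h4 := fun s : ℝ => (hid s).pow 4
  have h3 := fun s : ℝ => (hid s).pow 3
  simp only [id, Nat.cast_ofNat, mul_one] at h2 h3 h4
  have hψ : ∀ s, HasDerivAt ψ (ψ₁ s) s := by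
    intro s
    refine ((hu s).sub ((((((h2 s).const_mul d).div_const 2).const_add c).add (hφ s)).add
      (((h2 s).const_add 1).mul (hN s)) |>.add
      (((h2 s).add (h4 s)).mul ((hL s).const_mul a)))).congr_deriv ?_
    simp only [ψ₁, id, Pi.pow_apply]
    norm_num
    ring
  have hψ₁ : HasDerivAt ψ₁ (u₂ - (φ₂ + d + 2 * N 0 + N₂ + 2 * (a * L 0))) 0 := by
    refine (hu₁.sub (((((hid 0).const_mul d).add hφ₁).add
      ((((hid 0).const_mul 2).mul (hN 0)).add (((h2 0).const_add 1).mul hN₁))).add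
      (((((hid 0).const_mul 2).add ((h3 0).const_mul 4)).mul ((hL 0).const_mul a)).add
        (((h2 0).add (h4 0)).mul (hL₁.const_mul a))))).congr_deriv ?_
    simp
    ring
  have hmax : IsLocalMax ψ 0 := Filter.Eventually.of_forall fun s => by
    have h0 : ψ 0 = 0 := by simp [ψ, heq]
    rw [h0]
    have := hle s
    simp only [ψ]
    nlinarith
  obtain ⟨ha, hb⟩ := secondDeriv_nonpos_of_isLocalMax hmax (Filter.Eventually.of_forall hψ) hψ₁
  refine ⟨?_, by linarith⟩
  simp only [ψ₁] at ha
  norm_num at ha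
  linarith

lemma secondDeriv_add_sum_sq_nonpos {κ : Type*} [Fintype κ] {g g₁ : ℝ → ℝ} {g₂ A : ℝ}
    {h h₁ : κ → ℝ → ℝ} {h₂ : κ → ℝ}
    (hg : ∀ s, HasDerivAt g (g₁ s) s) (hg₁ : HasDerivAt g₁ g₂ 0)
    (hh : ∀ l s, HasDerivAt (h l) (h₁ l s) s) (hh₁ : ∀ l, HasDerivAt (h₁ l) (h₂ l) 0)
    (hmax : ∀ s, g s + A / 2 * ∑ l, h l s ^ 2 ≤ g 0 + A / 2 * ∑ l, h l 0 ^ 2) :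
    g₂ + A * ∑ l, (h₁ l 0 ^ 2 + h l 0 * h₂ l) ≤ 0 := by
  have hψ : ∀ s, HasDerivAt (fun s => g s + A / 2 * ∑ l, h l s ^ 2)
      (g₁ s + A * ∑ l, h l s * h₁ l s) s := by
    intro s
    refine ((hg s).add ((HasDerivAt.fun_sum fun l _ => (hh l s).pow 2).const_mul
      (A / 2))).congr_deriv ?_
    simp only [Finset.mul_sum]
    congr 1
    refine Finset.sum_congr rfl fun l _ => ?_
    norm_num
    ring
  have hψ₁ : HasDerivAt (fun s => g₁ s + A * ∑ l, h l s * h₁ l s)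
      (g₂ + A * ∑ l, (h₁ l 0 ^ 2 + h l 0 * h₂ l)) 0 := by
    refine (hg₁.add ((HasDerivAt.fun_sum fun l _ => (hh l 0).mul (hh₁ l)).const_mul
      A)).congr_deriv ?_
    congr 2
    refine Finset.sum_congr rfl fun l _ => ?_
    ring
  exact (secondDeriv_nonpos_of_isLocalMax (Filter.Eventually.of_forall hmax)
    (Filter.Eventually.of_forall hψ) hψ₁).2

lemma sum_mul_add_mul_expand {ι : Type*} [Fintype ι] (F X Y lam : ι → ℝ) (A h : ℝ) :
    ∑ i, F i * (X i + A * (lam i ^ 2 - h * lam i + Y i))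
      = ∑ i, F i * X i
        + A * (∑ i, F i * lam i ^ 2 - h * ∑ i, F i * lam i + ∑ i, F i * Y i) := by
  simp only [Finset.mul_sum, ← Finset.sum_add_distrib, ← Finset.sum_sub_distrib]
  exact Finset.sum_congr rfl fun i _ => by ring

/-! ### The differential inequality at a maximum of the test function -/

section MaximumPoint

variable {E : Type*} [NormedAddCommGroup E] [NormedSpace ℝ E]

/-- The family obtained by adjoining the vector `x` to the family `e`. -/
def adjoin {ι : Type*} (x : E) (e : ι → E) : Option ι → E := fun o => o.elim x e

/-- The inequality satisfied at a space-time maximum point `(x₀, t₀)` of the function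
`H_jj + (A / 2) |DH|²`, when `∂ₜ H` is touched from above along the lines `x₀ + s e_l`. -/
lemma max_point_inequality {ι : Type*} [Fintype ι] [DecidableEq ι] {H : E × ℝ → ℝ}
    (hH : ContDiffOn ℝ ∞ H (punctured E)) (hom : IsHom 1 H)
    {φ : E → ℝ} (hφ : ContDiffOn ℝ ∞ φ {0}ᶜ) {x₀ : E} {e : ι → E}
    (hline : ∀ (i : ι) (s : ℝ), x₀ + s • e i ≠ 0) (hx₀ : x₀ ≠ 0) {t₀ : ℝ} (ht₀ : 0 < t₀)
    {lam F : ι → ℝ} {κ c d A : ℝ} (hF : ∀ i, 0 ≤ F i) (hFl : ∑ i, F i * lam i = κ)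
    (hdiag : ∀ i j, dd (e i, (0 : ℝ)) (dd (e j, (0 : ℝ)) H) (x₀, t₀) = if i = j then lam i else 0)
    (touch : ∀ (l : ι) (s : ℝ), dd ((0 : E), (1 : ℝ)) H (x₀ + s • e l, t₀) ≤
      c + d * s ^ 2 / 2 + φ (x₀ + s • e l)
      + (1 + s ^ 2) * (∑ i, F i * dd (e i, (0 : ℝ)) (dd (e i, (0 : ℝ)) H) (x₀ + s • e l, t₀))
      + s ^ 2 * (1 + s ^ 2)
        * (F l * dd (e l, (0 : ℝ)) (dd (e l, (0 : ℝ)) H) (x₀ + s • e l, t₀)))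
    (touch₀ : dd ((0 : E), (1 : ℝ)) H (x₀, t₀) = c + φ x₀ + κ)
    {j : ι} (Q : E × ℝ → ℝ)
    (hQ : ∀ p, Q p = dd (e j, (0 : ℝ)) (dd (e j, (0 : ℝ)) H) p
      + A / 2 * ∑ l, dd (adjoin x₀ e l, (0 : ℝ)) H p ^ 2)
    (hQs : ∀ (i : ι) (s : ℝ), Q (x₀ + s • e i, t₀) ≤ Q (x₀, t₀))
    (hQt : ∀ t, 0 < t → t ≤ t₀ → Q (x₀, t) ≤ Q (x₀, t₀)) :
    0 ≤ d + dd (e j) (dd (e j) φ) x₀ + 2 * κ + 2 * (F j * lam j)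
      + A * (H (x₀, t₀) * (c + φ x₀ + 2 * κ)
        + ∑ l, dd (e l, (0 : ℝ)) H (x₀, t₀) * dd (e l) φ x₀ - ∑ i, F i * lam i ^ 2) := by
  have hU : IsOpen (punctured E) := isOpen_punctured
  have hV : IsOpen ({0}ᶜ : Set E) := isOpen_compl_singleton
  set P : E × ℝ := (x₀, t₀) with hP
  have hPU : P ∈ punctured E := ⟨hx₀, ht₀⟩
  have hpt : ∀ (l : ι) (s : ℝ), P + s • ((e l, (0 : ℝ)) : E × ℝ) = (x₀ + s • e l, t₀) := by
    intro l s; simp [hP]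
  have hmem : ∀ (l : ι) (s : ℝ), P + s • ((e l, (0 : ℝ)) : E × ℝ) ∈ punctured E := by
    intro l s; rw [hpt]; exact ⟨hline l s, ht₀⟩
  have hsm : ∀ {G : E × ℝ → ℝ}, ContDiffOn ℝ ∞ G (punctured E) → ∀ v,
      ContDiffOn ℝ ∞ (dd v G) (punctured E) := fun hG v => contDiffOn_dd hU hG v
  have hl1 : ∀ {G : E × ℝ → ℝ}, ContDiffOn ℝ ∞ G (punctured E) → ∀ (l : ι) (s : ℝ),
      HasDerivAt (fun s : ℝ => G (P + s • ((e l, (0 : ℝ)) : E × ℝ)))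
        (dd (e l, (0 : ℝ)) G (P + s • ((e l, (0 : ℝ)) : E × ℝ))) s := fun hG l s =>
    hasDerivAt_line (differentiableAt_of_contDiffOn hU hG (hmem l s))
  have hl0 : ∀ {G : E × ℝ → ℝ}, ContDiffOn ℝ ∞ G (punctured E) → ∀ (l : ι),
      HasDerivAt (fun s : ℝ => G (P + s • ((e l, (0 : ℝ)) : E × ℝ)))
        (dd (e l, (0 : ℝ)) G P) 0 := fun hG l =>
    hasDerivAt_line_zero (differentiableAt_of_contDiffOn hU hG hPU)
  have hφ1 : ContDiffOn ℝ ∞ (fun p : E × ℝ => φ p.1) (punctured E) :=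
    hφ.comp contDiffOn_fst fun p hp => hp.1
  let T : E × ℝ := ((0 : E), (1 : ℝ))
  let v : ι → E × ℝ := fun i => (e i, (0 : ℝ))
  let N : E × ℝ → ℝ := fun p => ∑ i, F i * dd (v i) (dd (v i) H) p
  have hN : ContDiffOn ℝ ∞ N (punctured E) :=
    ContDiffOn.sum fun i _ => contDiffOn_const.mul (hsm (hsm hH _) _)
  have hNl : ∀ l, dd (v l) N P = ∑ i, F i * dd (v l) (dd (v i) (dd (v i) H)) P := by
    intro l
    exact (hl0 hN l).unique (HasDerivAt.fun_sum fun i _ => (hl0 (hsm (hsm hH _) _) l).const_mul _)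
  have hNll : ∀ l, dd (v l) (dd (v l) N) P
      = ∑ i, F i * dd (v l) (dd (v l) (dd (v i) (dd (v i) H))) P := by
    intro l
    have : EqOn (dd (v l) N) (fun p => ∑ i, F i * dd (v l) (dd (v i) (dd (v i) H)) p)
        (punctured E) := by
      intro p hp
      have h1 := fun {G : E × ℝ → ℝ} (hG : ContDiffOn ℝ ∞ G (punctured E)) =>
        hasDerivAt_line_zero (v := v l) (differentiableAt_of_contDiffOn hU hG hp)
      exact (h1 hN).unique
        (HasDerivAt.fun_sum fun i _ => (h1 (hsm (hsm hH _) _)).const_mul _)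
    rw [dd_congr hU this hPU]
    have hs : ContDiffOn ℝ ∞ (fun p => ∑ i, F i * dd (v l) (dd (v i) (dd (v i) H)) p)
        (punctured E) :=
      ContDiffOn.sum fun i _ => contDiffOn_const.mul (hsm (hsm (hsm hH _) _) _)
    exact (hl0 hs l).unique
      (HasDerivAt.fun_sum fun i _ => (hl0 (hsm (hsm (hsm hH _) _) _) l).const_mul _)
  have hdiag' : ∀ i, dd (v i) (dd (v i) H) P = lam i := fun i => by simpa using hdiag i i
  have hN0 : N P = κ := by simp only [N, hdiag', hFl]
  have hd1 : ∀ w : E, dd (w, (0 : ℝ)) (fun p : E × ℝ => φ p.1) P = dd w φ x₀ := fun w =>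
    dd_slice hφ1 hx₀ ht₀ w
  have hd2 : ∀ w : E, dd (w, (0 : ℝ)) (dd (w, (0 : ℝ)) (fun p : E × ℝ => φ p.1)) P
      = dd w (dd w φ) x₀ := fun w => by
    rw [hP, dd_slice (hsm hφ1 _) hx₀ ht₀]
    exact dd_congr hV (fun z hz => dd_slice hφ1 hz ht₀ w) hx₀ w
  -- The comparison stands in for differentiating the equation twice: concavity is already contained
  -- in the touching function, and no second derivative of log σ_k is needed.
  have htouch : ∀ l, dd (v l) (dd T H) P = dd (e l) φ x₀ + dd (v l) N P ∧
      dd (v l) (dd (v l) (dd T H)) P ≤ dd (e l) (dd (e l) φ) x₀ + d + 2 * κ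
        + dd (v l) (dd (v l) N) P + 2 * (F l * lam l) := by
    intro l
    have := derivs_of_touching_above (c := c) (d := d) (a := F l)
      (hl1 (hsm hH T) l) (hl0 (hsm (hsm hH T) _) l) (hl1 hφ1 l) (hl0 (hsm hφ1 _) l)
      (hl1 hN l) (hl0 (hsm hN _) l) (hl1 (hsm (hsm hH (v l)) (v l)) l)
      (hl0 (hsm (hsm (hsm hH (v l)) (v l)) _) l)
      (fun s => by simp only [hpt]; exact touch l s)
      (by simp only [zero_smul, add_zero, hN0]; exact touch₀)
    simp only [zero_smul, add_zero, hN0, hdiag', hd1, hd2] at this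
    exact this
  -- radial derivatives
  let v₀ : E × ℝ := (x₀, (0 : ℝ))
  have hom0 : ∀ i, IsHom 0 (dd (v i) H) := fun i => hom.dd_space hH (e i)
  have homm : ∀ i, IsHom (-1) (dd (v i) (dd (v i) H)) := fun i =>
    (hom0 i).dd_space (hsm hH _) (e i)
  have hr1 : dd v₀ H P = H P := by simpa using hom.euler hH hx₀ ht₀
  have hr2 : dd T (dd v₀ H) P = c + φ x₀ + κ := by
    rw [dd_comm hU hH hPU, ← touch₀]
    simpa using (hom.dd_time hH).euler (hsm hH T) hx₀ ht₀
  have hr3 : ∀ i, dd (v i) (dd v₀ H) P = 0 := by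
    intro i
    rw [dd_comm hU hH hPU]
    simpa using (hom0 i).euler (hsm hH _) hx₀ ht₀
  -- Second derivatives of H have degree -1. Multiplied by the radial derivative H itself, this
  -- produces the term -H λ_i in `hspace`.
  have hr4 : ∀ i, dd (v i) (dd (v i) (dd v₀ H)) P = - lam i := by
    intro i
    have h1 : EqOn (dd (v i) (dd v₀ H)) (dd v₀ (dd (v i) H)) (punctured E) :=
      fun p hp => dd_comm hU hH hp _ _
    rw [dd_congr hU h1 hPU, dd_comm hU (hsm hH _) hPU, ← hdiag']
    simpa using (homm i).euler (hsm (hsm hH _) _) hx₀ ht₀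
  -- the maximum in space
  have hspace : ∀ i, dd (v i) (dd (v i) (dd (v j) (dd (v j) H))) P
      + A * (lam i ^ 2 - H P * lam i
        + ∑ l, dd (v l) H P * dd (v i) (dd (v i) (dd (v l) H)) P) ≤ 0 := by
    intro i
    have := secondDeriv_add_sum_sq_nonpos (A := A) (hl1 (hsm (hsm hH (v j)) (v j)) i)
      (hl0 (hsm (hsm (hsm hH (v j)) (v j)) _) i)
      (h := fun (l : Option ι) s => dd (adjoin x₀ e l, (0 : ℝ)) H (P + s • ((e i, (0 : ℝ)) : E × ℝ)))
      (fun l => hl1 (hsm hH (adjoin x₀ e l, (0 : ℝ))) i)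
      (fun l => hl0 (hsm (hsm hH (adjoin x₀ e l, (0 : ℝ))) _) i)
      (fun s => by
        simp only [hpt, zero_smul, add_zero]
        have := hQs i s
        rw [hQ, hQ] at this
        exact this)
    simp only [zero_smul, add_zero, Fintype.sum_option] at this
    have e0 : ((adjoin x₀ e none, (0 : ℝ)) : E × ℝ) = v₀ := rfl
    have es : ∀ l : ι, ((adjoin x₀ e (some l), (0 : ℝ)) : E × ℝ) = v l := fun l => rfl
    have ei : ((e i, (0 : ℝ)) : E × ℝ) = v i := rfl
    simp only [e0, es, ei, hr3, hr1, hr4, Finset.sum_add_distrib] at this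
    have hsq : ∑ l, dd (v i) (dd (v l) H) P ^ 2 = lam i ^ 2 := by
      have : ∀ l, dd (v i) (dd (v l) H) P = if i = l then lam i else 0 := hdiag i
      simp [this]
    rw [hsq] at this
    linarith
  -- the maximum in time
  have htime : 0 ≤ dd T (dd (v j) (dd (v j) H)) P
      + A * (H P * (c + φ x₀ + κ) + ∑ l, dd (v l) H P * dd T (dd (v l) H) P) := by
    have hlt : ∀ {G : E × ℝ → ℝ}, ContDiffOn ℝ ∞ G (punctured E) →
        HasDerivAt (fun t : ℝ => G (x₀, t)) (dd T G P) t₀ := by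
      intro G hG
      have hG' : DifferentiableAt ℝ G (x₀, t₀) := differentiableAt_of_contDiffOn hU hG hPU
      have hl : HasDerivAt (fun t : ℝ => ((x₀, t) : E × ℝ)) T t₀ :=
        (hasDerivAt_const t₀ x₀).prodMk (hasDerivAt_id t₀)
      exact hG'.hasFDerivAt.comp_hasDerivAt t₀ hl
    have hder : HasDerivAt (fun t : ℝ => Q (x₀, t))
        (dd T (dd (v j) (dd (v j) H)) P + A / 2 * ∑ l : Option ι,
          2 * dd (adjoin x₀ e l, (0 : ℝ)) H P * dd T (dd (adjoin x₀ e l, (0 : ℝ)) H) P) t₀ := by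
      simp only [hQ]
      refine ((hlt (hsm (hsm hH (v j)) (v j))).add ((HasDerivAt.fun_sum fun l _ =>
        (hlt (hsm hH (adjoin x₀ e l, (0 : ℝ)))).pow 2).const_mul (A / 2))).congr_deriv ?_
      congr 2
      refine Finset.sum_congr rfl fun l _ => ?_
      norm_num
      exact Or.inl rfl
    have := deriv_nonneg_of_forall_le ht₀ hder hQt
    simp only [Fintype.sum_option] at this
    have e0 : ((adjoin x₀ e none, (0 : ℝ)) : E × ℝ) = v₀ := rfl
    have es : ∀ l : ι, ((adjoin x₀ e (some l), (0 : ℝ)) : E × ℝ) = v l := fun l => rfl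
    simp only [e0, es, hr1, hr2, mul_assoc, ← Finset.mul_sum] at this
    linarith
  have hcomm1 : dd T (dd (v j) (dd (v j) H)) P = dd (v j) (dd (v j) (dd T H)) P := by
    rw [dd_comm hU (hsm hH _) hPU]
    exact dd_congr hU (fun p hp => dd_comm hU hH hp _ _) hPU _
  have hcomm2 : ∀ l, dd T (dd (v l) H) P = dd (v l) (dd T H) P := fun l => dd_comm hU hH hPU _ _
  have hcomm3 : ∀ i l, dd (v i) (dd (v i) (dd (v l) H)) P
      = dd (v l) (dd (v i) (dd (v i) H)) P := by
    intro i l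
    rw [dd_comm hU (hsm hH (v i)) hPU (v l) (v i)]
    exact dd_congr hU (fun p hp => dd_comm hU hH hp (v i) (v l)) hPU _
  have hcomm4 : ∀ i l, dd (v i) (dd (v i) (dd (v l) (dd (v l) H))) P
      = dd (v l) (dd (v l) (dd (v i) (dd (v i) H))) P := by
    intro i l
    have h1 : EqOn (dd (v i) (dd (v l) (dd (v l) H))) (dd (v l) (dd (v l) (dd (v i) H)))
        (punctured E) := by
      intro p hp
      rw [dd_comm hU (hsm hH _) hp]
      exact dd_congr hU (fun q hq => dd_comm hU hH hq _ _) hp _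
    have h2 : EqOn (dd (v i) (dd (v l) (dd (v i) H))) (dd (v l) (dd (v i) (dd (v i) H)))
        (punctured E) := fun p hp => dd_comm hU (hsm hH _) hp _ _
    rw [dd_congr hU h1 hPU, dd_comm hU (hsm (hsm hH _) _) hPU]
    exact dd_congr hU h2 hPU _
  have hsum : ∑ i, F i * (dd (v i) (dd (v i) (dd (v j) (dd (v j) H))) P
      + A * (lam i ^ 2 - H P * lam i
        + ∑ l, dd (v l) H P * dd (v i) (dd (v i) (dd (v l) H)) P)) ≤ 0 :=
    Finset.sum_nonpos fun i _ => mul_nonpos_of_nonneg_of_nonpos (hF i) (hspace i)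
  have hexp : ∑ i, F i * (dd (v i) (dd (v i) (dd (v j) (dd (v j) H))) P
      + A * (lam i ^ 2 - H P * lam i
        + ∑ l, dd (v l) H P * dd (v i) (dd (v i) (dd (v l) H)) P))
      = dd (v j) (dd (v j) N) P + A * (∑ i, F i * lam i ^ 2 - H P * κ
        + ∑ l, dd (v l) H P * dd (v l) N P) := by
    have hswap : ∑ l, dd (v l) H P * dd (v l) N P
        = ∑ i, F i * ∑ l, dd (v l) H P * dd (v i) (dd (v i) (dd (v l) H)) P := by
      simp_rw [hNl, Finset.mul_sum]
      rw [Finset.sum_comm]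
      exact Finset.sum_congr rfl fun i _ => Finset.sum_congr rfl fun l _ => by
        rw [hcomm3 i l]; ring
    rw [hswap, hNll, ← hFl, ← Finset.sum_congr rfl fun i _ => by rw [hcomm4 i j]]
    exact sum_mul_add_mul_expand _ _ _ _ _ _
  rw [hexp] at hsum
  rw [hcomm1] at htime
  simp only [hcomm2, (htouch _).1] at htime
  simp only [mul_add, Finset.sum_add_distrib] at htime hsum ⊢
  have hj := (htouch j).2
  have e1 : ∀ l, dd (e l, (0 : ℝ)) H P = dd (v l) H P := fun l => rfl
  simp only [e1]
  linarith

end MaximumPoint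

/-! ### Support functions, inner and outer radii -/

/-- The support function of a convex body, as a function on the whole space. -/
def supp (Ω : ConvexBody (Eu m)) (y : Eu m) : ℝ :=
  sSup ((fun Y : Eu m => ⟪y, Y⟫_ℝ) '' (Ω : Set (Eu m)))

lemma suppFn_eq_supp (Ω : ConvexBody (Eu m)) (x : Sph m) : suppFn Ω x = supp Ω x := rfl

lemma inner_le_supp (Ω : ConvexBody (Eu m)) (y : Eu m) {Y : Eu m} (hY : Y ∈ Ω) :
    ⟪y, Y⟫_ℝ ≤ supp Ω y := by
  refine le_csSup ?_ (mem_image_of_mem _ hY)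
  exact (Ω.isCompact.image (f := fun Y : Eu m => ⟪y, Y⟫_ℝ) (by fun_prop)).bddAbove

lemma supp_le (Ω : ConvexBody (Eu m)) (y : Eu m) {c : ℝ} (h : ∀ Y ∈ Ω, ⟪y, Y⟫_ℝ ≤ c) :
    supp Ω y ≤ c := by
  refine csSup_le (Ω.nonempty.image _) ?_
  rintro _ ⟨Y, hY, rfl⟩
  exact h Y hY

lemma supp_smul_right (Ω : ConvexBody (Eu m)) {c : ℝ} (hc : 0 ≤ c) (y : Eu m) :
    supp Ω (c • y) = c * supp Ω y := by
  rw [← smul_eq_mul, supp, supp, ← Real.sSup_smul_of_nonneg hc, ← image_smul, image_image]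
  simp only [inner_smul_left, smul_eq_mul]
  rfl

lemma supp_smul_left (Ω : ConvexBody (Eu m)) {θ : ℝ} (hθ : 0 ≤ θ) (y : Eu m) :
    supp (θ • Ω) y = θ * supp Ω y := by
  rw [← smul_eq_mul, supp, supp, ← Real.sSup_smul_of_nonneg hθ, ← image_smul, image_image,
    ConvexBody.coe_smul, ← image_smul, image_image]
  simp only [inner_smul_right, smul_eq_mul]

lemma mem_of_forall_inner_le_supp (Ω : ConvexBody (Eu m)) {Z : Eu m}
    (h : ∀ y, ⟪y, Z⟫_ℝ ≤ supp Ω y) : Z ∈ Ω := by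
  by_contra hZ
  obtain ⟨f, u, hf, hu⟩ := geometric_hahn_banach_closed_point Ω.convex Ω.isClosed hZ
  have hrep : ∀ z, ⟪(InnerProductSpace.toDual ℝ (Eu m)).symm f, z⟫_ℝ = f z := fun z =>
    InnerProductSpace.toDual_symm_apply
  have h1 := h ((InnerProductSpace.toDual ℝ (Eu m)).symm f)
  have h2 := supp_le Ω ((InnerProductSpace.toDual ℝ (Eu m)).symm f) (c := u)
    fun Y hY => by rw [hrep]; exact (hf Y hY).le
  rw [hrep] at h1
  linarith

lemma le_innerRadius (Ω : ConvexBody (Eu m)) {ρ : ℝ} (hρ : 0 ≤ ρ) {c : Eu m}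
    (h : closedBall c ρ ⊆ (Ω : Set (Eu m))) : ρ ≤ innerRadius Ω := by
  -- The supremum is meaningful only for a bounded set of radii. The unit vector used for the bound
  -- exists because the dimension m + 1 is positive.
  obtain ⟨B, hB⟩ := Ω.isBounded.subset_closedBall (0 : Eu m)
  refine le_csSup ⟨2 * B, ?_⟩ ⟨hρ, c, h⟩
  rintro r ⟨hr, z, hz⟩
  set e : Eu m := EuclideanSpace.single 0 1
  have he : ‖e‖ = 1 := by simp [e]
  have h1 : ‖z‖ ≤ B := by simpa using hB (hz (mem_closedBall_self hr))
  have h2 : ‖z + r • e‖ ≤ B := by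
    have : z + r • e ∈ closedBall z r := by
      simp [norm_smul, he, abs_of_nonneg hr]
    simpa using hB (hz this)
  have h3 : ‖r • e‖ ≤ ‖z + r • e‖ + ‖z‖ := by
    simpa using norm_sub_le (z + r • e) z
  rw [norm_smul, he, Real.norm_of_nonneg hr] at h3
  linarith

lemma outerRadius_nonneg (Ω : ConvexBody (Eu m)) : 0 ≤ outerRadius Ω :=
  Real.sInf_nonneg fun _ h => h.1

/-- The ball centred at one end of a longest chord, with the length of the chord as radius, contains
the body. -/
lemma exists_outerRadius_le_dist (Ω : ConvexBody (Eu m)) :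
    ∃ p ∈ Ω, ∃ q ∈ Ω, outerRadius Ω ≤ dist p q := by
  obtain ⟨z, hz, hmax⟩ := (Ω.isCompact.prod Ω.isCompact).exists_isMaxOn
    (Ω.nonempty.prod Ω.nonempty) (f := fun z : Eu m × Eu m => dist z.1 z.2)
    continuous_dist.continuousOn
  have hmax' : ∀ y ∈ (Ω : Set (Eu m)), dist z.1 y ≤ dist z.1 z.2 := fun y hy =>
    isMaxOn_iff.1 hmax (z.1, y) ⟨hz.1, hy⟩
  refine ⟨z.1, hz.1, z.2, hz.2, csInf_le ?_ ?_⟩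
  · exact ⟨0, by rintro r ⟨hr, -⟩; exact hr⟩
  · refine ⟨dist_nonneg, z.1, fun y hy => ?_⟩
    rw [mem_closedBall, dist_comm]
    exact hmax' y hy

lemma dist_le_two_mul_outerRadius (Ω : ConvexBody (Eu m)) {p q : Eu m} (hp : p ∈ Ω)
    (hq : q ∈ Ω) : dist p q ≤ 2 * outerRadius Ω := by
  have : dist p q / 2 ≤ outerRadius Ω := by
    obtain ⟨B, hB⟩ := Ω.isBounded.subset_closedBall (0 : Eu m)
    refine le_csInf ⟨max B 0, le_max_right _ _, 0, hB.trans
      (closedBall_subset_closedBall (le_max_left _ _))⟩ ?_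
    rintro r ⟨-, c, hc⟩
    have h1 : dist p c ≤ r := hc hp
    have h2 : dist q c ≤ r := hc hq
    have := dist_triangle_right p q c
    linarith
  linarith

/-- With the origin in the body, every point of the body has norm at most twice the outer radius. -/
lemma abs_supp_le (Ω : ConvexBody (Eu m)) (h0 : (0 : Eu m) ∈ Ω) (y : Eu m) :
    0 ≤ supp Ω y ∧ supp Ω y ≤ 2 * outerRadius Ω * ‖y‖ := by
  refine ⟨by simpa using inner_le_supp Ω y h0, supp_le Ω y fun Y hY => ?_⟩
  have h1 := real_inner_le_norm y Y
  have h2 := dist_le_two_mul_outerRadius Ω hY h0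
  rw [dist_zero_right] at h2
  nlinarith [norm_nonneg y]

lemma supp_sub_le (Ω : ConvexBody (Eu m)) (h0 : (0 : Eu m) ∈ Ω) (y z : Eu m) :
    supp Ω y - supp Ω z ≤ 2 * outerRadius Ω * ‖y - z‖ := by
  rw [sub_le_iff_le_add]
  refine supp_le Ω y fun Y hY => ?_
  have h1 := real_inner_le_norm (y - z) Y
  rw [inner_sub_left] at h1
  have h2 := dist_le_two_mul_outerRadius Ω hY h0
  rw [dist_zero_right] at h2
  have h3 := inner_le_supp Ω z hY
  nlinarith [norm_nonneg (y - z)]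

/-- If the second differences of the support function are at most those of a ball of radius `M`,
then the body contains the ball of radius `d² / (16 M)` around the midpoint of any of its chords of
length `d ≤ 4 M`. -/
lemma closedBall_midpoint_subset (Ω : ConvexBody (Eu m)) {M : ℝ} (hM : 0 < M) {p q : Eu m}
    (hp : p ∈ Ω) (hq : q ∈ Ω) (hd : dist p q ≤ 4 * M)
    (h : ∀ u w : Eu m, ‖u‖ = 1 → ⟪u, w⟫_ℝ = 0 →
      supp Ω (u + w) + supp Ω (u - w) - 2 * supp Ω u ≤ M * ‖w‖ ^ 2) :
    closedBall ((1 / 2 : ℝ) • (p + q)) (dist p q ^ 2 / (16 * M)) ⊆ (Ω : Set (Eu m)) := by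
  set d := dist p q with hdd
  have hd0 : 0 ≤ d := dist_nonneg
  set c : Eu m := (1 / 2 : ℝ) • (p + q)
  set D : Eu m := (1 / 2 : ℝ) • (p - q)
  have hcp : c + D = p := by simp only [c, D]; module
  have hcq : c - D = q := by simp only [c, D]; module
  have hD : ‖D‖ ^ 2 = d ^ 2 / 4 := by
    rw [norm_smul, ← dist_eq_norm, ← hdd]; norm_num; ring
  -- In terms of support functions, this is the inclusion of the ball. The cases separate chords
  -- that are far from parallel to u, where the second difference bound is used, from the others,
  -- where an endpoint of the chord suffices.
  have key : ∀ u : Eu m, ‖u‖ = 1 → ⟪u, c⟫_ℝ + d ^ 2 / (16 * M) ≤ supp Ω u := by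
    intro u hu
    set β := ⟪u, D⟫_ℝ
    have hp' : ∀ y, ⟪y, c⟫_ℝ + ⟪y, D⟫_ℝ ≤ supp Ω y := fun y => by
      rw [← inner_add_right, hcp]; exact inner_le_supp Ω y hp
    have hq' : ∀ y, ⟪y, c⟫_ℝ - ⟪y, D⟫_ℝ ≤ supp Ω y := fun y => by
      rw [← inner_sub_right, hcq]; exact inner_le_supp Ω y hq
    by_cases hβ : β ^ 2 ≤ d ^ 2 / 8
    · set v : Eu m := D - β • u
      have huu : ⟪u, u⟫_ℝ = 1 := by rw [real_inner_self_eq_norm_sq, hu]; norm_num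
      have huv : ⟪u, v⟫_ℝ = 0 := by
        simp only [v, inner_sub_right, inner_smul_right, huu]; simp [β]
      have hvD : ⟪v, D⟫_ℝ = d ^ 2 / 4 - β ^ 2 := by
        simp only [v, inner_sub_left, inner_smul_left, real_inner_self_eq_norm_sq, hD]
        simp only [β, conj_trivial]; ring
      have hvv : ‖v‖ ^ 2 = d ^ 2 / 4 - β ^ 2 := by
        rw [← hvD, ← real_inner_self_eq_norm_sq]
        have : ⟪v, D⟫_ℝ = ⟪v, v + β • u⟫_ℝ := by simp [v]
        rw [this, inner_add_right, inner_smul_right, real_inner_comm u v, huv]; simp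
      -- Testing u ± w against the two endpoints gains 2⟪w, D⟫ and costs at most M‖w‖²; over w
      -- parallel to v, the choice w = v / M is optimal.
      have h1 := h u (M⁻¹ • v) hu (by rw [inner_smul_right, huv, mul_zero])
      have h2 := hp' (u + M⁻¹ • v)
      have h3 := hq' (u - M⁻¹ • v)
      rw [norm_smul, mul_pow, hvv, Real.norm_of_nonneg (by positivity)] at h1
      simp only [inner_add_left, inner_sub_left, inner_smul_left, hvD, conj_trivial] at h2 h3
      have h4 : M * (M⁻¹ ^ 2 * (d ^ 2 / 4 - β ^ 2)) = M⁻¹ * (d ^ 2 / 4 - β ^ 2) := by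
        field_simp
      have h5 : d ^ 2 / (16 * M) = M⁻¹ * (d ^ 2 / 4 - d ^ 2 / 8) / 2 := by
        field_simp; ring
      have h6 : M⁻¹ * (d ^ 2 / 4 - d ^ 2 / 8) ≤ M⁻¹ * (d ^ 2 / 4 - β ^ 2) := by
        gcongr
      linarith
    -- Here the gain |⟪u, D⟫| ≥ d/4 of one endpoint is enough, because d ≤ 4M.
    · push Not at hβ
      have h1 : d ^ 2 / (16 * M) ≤ d / 4 := by
        rw [div_le_div_iff₀ (by positivity) (by norm_num)]; nlinarith
      have h2 : d / 4 ≤ |β| := by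
        refine le_of_sq_le_sq ?_ (abs_nonneg _)
        rw [sq_abs]; nlinarith
      have h3 := hp' u
      have h4 := hq' u
      rcases abs_cases β with ⟨h5, -⟩ | ⟨h5, -⟩ <;> linarith
  intro Z hZ
  refine mem_of_forall_inner_le_supp Ω fun y => ?_
  rcases eq_or_ne y 0 with rfl | hy
  · simpa using inner_le_supp Ω 0 hp
  have hyn : 0 < ‖y‖ := norm_pos_iff.2 hy
  have h1 := key (‖y‖⁻¹ • y) (by rw [norm_smul, norm_inv, norm_norm, inv_mul_cancel₀ hyn.ne'])
  rw [supp_smul_right Ω (by positivity), inner_smul_left, conj_trivial] at h1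
  have h2 : ⟪y, c⟫_ℝ + ‖y‖ * (d ^ 2 / (16 * M)) ≤ supp Ω y := by
    have := mul_le_mul_of_nonneg_left h1 hyn.le
    rwa [mul_add, mul_inv_cancel_left₀ hyn.ne', mul_inv_cancel_left₀ hyn.ne'] at this
  have h3 := real_inner_le_norm y (Z - c)
  rw [inner_sub_right] at h3
  have h4 : ‖Z - c‖ ≤ d ^ 2 / (16 * M) := by rw [← dist_eq_norm]; exact hZ
  nlinarith

/-- Subtracting K s²/2 makes the restriction to the line concave; compare its value at 0 with those
at 1 and -1. -/
lemma second_difference_le {E : Type*} [NormedAddCommGroup E] [NormedSpace ℝ E] {h : E → ℝ}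
    {U : Set E} (hU : IsOpen U) (hh : ContDiffOn ℝ ∞ h U) {u w : E} (hline : ∀ s : ℝ, u + s • w ∈ U)
    {K : ℝ} (hK : ∀ s : ℝ, dd w (dd w h) (u + s • w) ≤ K) :
    h (u + w) + h (u - w) - 2 * h u ≤ K := by
  let g : ℝ → ℝ := fun s => h (u + s • w) - K / 2 * s ^ 2
  let g₁ : ℝ → ℝ := fun s => dd w h (u + s • w) - K * s
  have hg : ∀ s, HasDerivAt g (g₁ s) s := fun s =>
    ((hasDerivAt_line (differentiableAt_of_contDiffOn hU hh (hline s))).sub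
      ((hasDerivAt_pow 2 s).const_mul (K / 2))).congr_deriv (by simp only [g₁]; norm_num; ring)
  have hg₁ : ∀ s, HasDerivAt g₁ (dd w (dd w h) (u + s • w) - K) s := fun s =>
    ((hasDerivAt_line (differentiableAt_of_contDiffOn hU (contDiffOn_dd hU hh w) (hline s))).sub
      ((hasDerivAt_id s).const_mul K)).congr_deriv (by ring)
  have hd : deriv g = g₁ := funext fun s => (hg s).deriv
  have hconc : ConcaveOn ℝ univ g := by
    refine concaveOn_univ_of_deriv2_nonpos (fun s => (hg s).differentiableAt)
      (by rw [hd]; exact fun s => (hg₁ s).differentiableAt) fun s => ?_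
    rw [Function.iterate_succ, Function.iterate_one, Function.comp, hd, (hg₁ s).deriv]
    linarith [hK s]
  have := hconc.2 (mem_univ (1 : ℝ)) (mem_univ (-1 : ℝ)) (show (0 : ℝ) ≤ 1 / 2 by norm_num)
    (show (0 : ℝ) ≤ 1 / 2 by norm_num) (by norm_num)
  simp only [g, smul_eq_mul] at this
  norm_num at this
  rw [← sub_eq_add_neg] at this
  linarith

/-! ### Radial projection and smoothness of homogeneous extensions -/

section RadialProjection

/-- The radial projection to the sphere, with an arbitrary value at the origin. -/
def sphereProj (y : Eu m) : Sph m :=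
  if hy : y = 0 then ⟨EuclideanSpace.single 0 1, by simp⟩
  else ⟨‖y‖⁻¹ • y, by simp [norm_smul, inv_mul_cancel₀ (norm_ne_zero_iff.mpr hy)]⟩

lemma coe_sphereProj {y : Eu m} (hy : y ≠ 0) : (sphereProj y : Eu m) = ‖y‖⁻¹ • y := by
  simp [sphereProj, hy]

lemma sphereProj_coe (x : Sph m) : sphereProj (x : Eu m) = x := by
  have hx : ‖(x : Eu m)‖ = 1 := by simp
  apply Subtype.ext
  rw [coe_sphereProj (by rw [← norm_ne_zero_iff, hx]; norm_num), hx]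
  simp

lemma radialExt_eq_comp {u : Sph m → ℝ} {y : Eu m} (hy : y ≠ 0) :
    radialExt u y = u (sphereProj y) := by
  simp [radialExt, sphereProj, hy]

lemma sphere_ne_zero (x : Sph m) : (x : Eu m) ≠ 0 := by
  rw [← norm_ne_zero_iff]; simp

lemma contMDiffAt_sphereProj {y : Eu m} (hy : y ≠ 0) :
    ContMDiffAt 𝓘(ℝ, Eu m) (𝓡 m) ∞ (sphereProj : Eu m → Sph m) y := by
  let U : TopologicalSpace.Opens (Eu m) := ⟨{0}ᶜ, isOpen_compl_singleton⟩
  have hU : ∀ z : U, (z : Eu m) ≠ 0 := fun z => z.2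
  have hnorm : ContMDiff 𝓘(ℝ, Eu m) 𝓘(ℝ, Eu m) ∞
      (fun z : U => ‖(z : Eu m)‖⁻¹ • (z : Eu m)) := by
    intro z
    refine contMDiffAt_subtype_iff (f := fun y : Eu m => ‖y‖⁻¹ • y).2 ?_
    exact (((contDiffAt_norm ℝ (hU z)).inv (norm_ne_zero_iff.2 (hU z))).smul
      contDiffAt_id).contMDiffAt
  have : Fact (Module.finrank ℝ (Eu m) = m + 1) := ⟨finrank_euclideanSpace_fin⟩
  have hs := hnorm.codRestrict_sphere (n := m) fun z => by
    simp [norm_smul, inv_mul_cancel₀ (norm_ne_zero_iff.mpr (hU z))]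
  refine contMDiffAt_subtype_iff (U := U) (x := ⟨y, hy⟩).1 ?_
  refine (hs ⟨y, hy⟩).congr_of_eventuallyEq (Filter.Eventually.of_forall fun z => ?_)
  apply Subtype.ext
  rw [coe_sphereProj (hU z)]
  rfl

lemma contDiffOn_comp_sphereProj {f : Sph m → ℝ} (hf : ContMDiff (𝓡 m) 𝓘(ℝ, ℝ) ∞ f) :
    ContDiffOn ℝ ∞ (fun y : Eu m => f (sphereProj y)) {0}ᶜ := by
  intro y hy
  have : ContMDiffAt 𝓘(ℝ, Eu m) 𝓘(ℝ, ℝ) ∞ (fun y : Eu m => f (sphereProj y)) y :=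
    (hf (sphereProj y)).comp y (contMDiffAt_sphereProj hy)
  exact this.contDiffAt.contDiffWithinAt

lemma contDiffOn_comp_sphereProj_prod {f : Sph m × ℝ → ℝ}
    (hf : ContMDiffOn ((𝓡 m).prod 𝓘(ℝ, ℝ)) 𝓘(ℝ, ℝ) ∞ f (univ ×ˢ Ioi 0)) :
    ContDiffOn ℝ ∞ (fun p : Eu m × ℝ => f (sphereProj p.1, p.2)) (punctured (Eu m)) := by
  intro p hp
  have h1 : ContMDiffAt 𝓘(ℝ, Eu m × ℝ) (𝓡 m) ∞ (fun p : Eu m × ℝ => sphereProj p.1) p :=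
    (contMDiffAt_sphereProj hp.1).comp p contDiffAt_fst.contMDiffAt
  have h2 : ContMDiffAt 𝓘(ℝ, Eu m × ℝ) 𝓘(ℝ, ℝ) ∞ (fun p : Eu m × ℝ => p.2) p :=
    contDiffAt_snd.contMDiffAt
  have h3 : ContMDiffAt ((𝓡 m).prod 𝓘(ℝ, ℝ)) 𝓘(ℝ, ℝ) ∞ f (sphereProj p.1, p.2) :=
    hf.contMDiffAt ((isOpen_univ.prod isOpen_Ioi).mem_nhds ⟨mem_univ _, hp.2⟩)
  have : ContMDiffAt 𝓘(ℝ, Eu m × ℝ) 𝓘(ℝ, ℝ) ∞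
      (fun p : Eu m × ℝ => f (sphereProj p.1, p.2)) p :=
    h3.comp p (h1.prodMk h2)
  exact this.contDiffAt.contDiffWithinAt

lemma supp_eq_norm_mul (Ω : ConvexBody (Eu m)) {y : Eu m} (hy : y ≠ 0) :
    supp Ω y = ‖y‖ * suppFn Ω (sphereProj y) := by
  have hn : ‖y‖ ≠ 0 := norm_ne_zero_iff.2 hy
  rw [suppFn_eq_supp, coe_sphereProj hy, supp_smul_right Ω (by positivity),
    mul_inv_cancel_left₀ hn]

lemma contDiffOn_norm : ContDiffOn ℝ ∞ (fun y : Eu m => ‖y‖) {0}ᶜ := fun _ hy =>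
  (contDiffAt_norm ℝ hy).contDiffWithinAt

end RadialProjection

/-! ### The spherical Hessian as a flat Hessian -/

section SphericalHessian

lemma dd_norm {y : Eu m} (hy : y ≠ 0) (w : Eu m) :
    ‖y‖ * dd w (fun y : Eu m => ‖y‖) y = ⟪y, w⟫_ℝ := by
  have h1 := hasDerivAt_line_zero (v := w) ((contDiffAt_norm ℝ (n := 1) hy).differentiableAt
    one_ne_zero)
  have h2 := h1.pow 2
  have h3 : HasDerivAt (fun s : ℝ => ‖y + s • w‖ ^ 2) (2 * ⟪y, w⟫_ℝ) 0 := by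
    have hl : HasDerivAt (fun s : ℝ => y + s • w) w 0 := by
      simpa using ((hasDerivAt_id (0 : ℝ)).smul_const w).const_add y
    simpa using hl.norm_sq
  have := h2.unique h3
  simp at this
  linarith

lemma dd_mul {F : Type*} [NormedAddCommGroup F] [NormedSpace ℝ F] {G K : F → ℝ} {p : F}
    (hG : DifferentiableAt ℝ G p) (hK : DifferentiableAt ℝ K p) (v : F) :
    dd v (fun q => G q * K q) p = dd v G p * K p + G p * dd v K p := by
  unfold dd
  rw [fderiv_fun_mul hG hK]
  simp
  ring

lemma dd_add {F : Type*} [NormedAddCommGroup F] [NormedSpace ℝ F] {G K : F → ℝ} {p : F}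
    (hG : DifferentiableAt ℝ G p) (hK : DifferentiableAt ℝ K p) (v : F) :
    dd v (fun q => G q + K q) p = dd v G p + dd v K p := by
  unfold dd
  rw [fderiv_fun_add hG hK]
  simp

lemma inner_gradient {U : Eu m → ℝ} (y w : Eu m) : ⟪gradient U y, w⟫_ℝ = dd w U y := by
  simp [gradient, dd]

lemma contDiffOn_gradient {U : Eu m → ℝ} (hU : ContDiffOn ℝ ∞ U {0}ᶜ) :
    ContDiffOn ℝ ∞ (gradient U) {0}ᶜ :=
  (InnerProductSpace.toDual ℝ (Eu m)).symm.contDiff.comp_contDiffOn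
    (hU.fderiv_of_isOpen isOpen_compl_singleton (m := ∞) (by simp))

variable {h : Eu m → ℝ} {u : Sph m → ℝ}

lemma contDiffOn_radialExt (hh : ContDiffOn ℝ ∞ h {0}ᶜ)
    (hu : ∀ y, y ≠ 0 → h y = ‖y‖ * radialExt u y) : ContDiffOn ℝ ∞ (radialExt u) {0}ᶜ := by
  refine ((contDiffOn_norm.inv fun y hy => norm_ne_zero_iff.2 hy).mul hh).congr fun y hy => ?_
  have hn : ‖y‖ ≠ 0 := norm_ne_zero_iff.2 hy
  change _ = ‖y‖⁻¹ * h y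
  rw [hu y hy, inv_mul_cancel_left₀ hn]

lemma inner_sphGradDeriv (hU : ContDiffOn ℝ ∞ (radialExt u) {0}ᶜ) (x : Sph m) (v w : Eu m) :
    ⟪sphGradDeriv u x v, w⟫_ℝ = dd v (dd w (radialExt u)) x := by
  have hx := sphere_ne_zero x
  have hd : DifferentiableAt ℝ (gradient (radialExt u)) (x : Eu m) :=
    ((contDiffOn_gradient hU).contDiffAt (isOpen_compl_singleton.mem_nhds hx)).differentiableAt
      (by simp)
  have : dd w (radialExt u) = fun y => ⟪gradient (radialExt u) y, w⟫_ℝ :=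
    funext fun y => (inner_gradient y w).symm
  rw [this]
  unfold dd sphGradDeriv
  rw [fderiv_inner_apply ℝ hd (differentiableAt_const w)]
  simp

/-- The second derivative of the homogeneous extension of degree one represents `∇² u + u I`. -/
lemma dd_dd_eq_inner_sphGradDeriv (hh : ContDiffOn ℝ ∞ h {0}ᶜ)
    (hu : ∀ y, y ≠ 0 → h y = ‖y‖ * radialExt u y) (x : Sph m) {v w : Eu m}
    (hv : ⟪(x : Eu m), v⟫_ℝ = 0) (hw : ⟪(x : Eu m), w⟫_ℝ = 0) :
    dd v (dd w h) (x : Eu m) = ⟪sphGradDeriv u x v, w⟫_ℝ + u x * ⟪v, w⟫_ℝ := by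
  have hV : IsOpen ({0}ᶜ : Set (Eu m)) := isOpen_compl_singleton
  have hU := contDiffOn_radialExt hh hu
  have hx := sphere_ne_zero x
  have hx1 : ‖(x : Eu m)‖ = 1 := by simp
  have hux : radialExt u (x : Eu m) = u x := by rw [radialExt_eq_comp hx, sphereProj_coe]
  let n : Eu m → ℝ := fun y => ‖y‖
  have hn : ContDiffOn ℝ ∞ n {0}ᶜ := contDiffOn_norm
  have hda := fun {G : Eu m → ℝ} (hG : ContDiffOn ℝ ∞ G {0}ᶜ) {y : Eu m} (hy : y ≠ 0) =>
    differentiableAt_of_contDiffOn hV hG hy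
  have hdn := fun z : Eu m => contDiffOn_dd hV hn z
  have hdU := fun z : Eu m => contDiffOn_dd hV hU z
  have h1 : EqOn (dd w h) (fun y => dd w n y * radialExt u y + n y * dd w (radialExt u) y)
      {0}ᶜ := by
    intro y hy
    have : EqOn h (fun y => n y * radialExt u y) {0}ᶜ := fun z hz => hu z hz
    rw [dd_congr hV this hy, dd_mul (hda hn hy) (hda hU hy)]
  have hnx : ∀ z : Eu m, dd z n x = ⟪(x : Eu m), z⟫_ℝ := fun z => by
    have := dd_norm hx z
    rwa [hx1, one_mul] at this
  -- Obtained by differentiating the identity ‖y‖ D_w‖y‖ = ⟪y, w⟫ in a tangential direction v.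
  have hnn : dd v (dd w n) (x : Eu m) = ⟪v, w⟫_ℝ := by
    have h2 : EqOn (fun y => n y * dd w n y) (fun y => ⟪y, w⟫_ℝ) {0}ᶜ := fun y hy => dd_norm hy w
    have h3 := dd_congr hV h2 hx v
    rw [dd_mul (hda hn hx) (hda (hdn w) hx), hnx, hnx, hv, zero_mul, zero_add] at h3
    have h4 : dd v (fun y : Eu m => ⟪y, w⟫_ℝ) x = ⟪v, w⟫_ℝ := by
      unfold dd
      rw [fderiv_inner_apply ℝ (f := fun y : Eu m => y) differentiableAt_id
        (differentiableAt_const w)]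
      simp
    rw [h4] at h3
    simpa [n, hx1] using h3
  -- Both mixed terms contain a tangential derivative of the norm at x, which is zero.
  rw [dd_congr hV h1 hx, dd_add, dd_mul (hda (hdn w) hx) (hda hU hx),
    dd_mul (hda hn hx) (hda (hdU w) hx), hnn, hnx, hnx, hv, hw, inner_sphGradDeriv hU, hux]
  · simp only [n, hx1]; ring
  · exact (hda (hdn w) hx).mul (hda hU hx)
  · exact (hda hn hx).mul (hda (hdU w) hx)

lemma inner_radiiOp (u : Sph m → ℝ) (x : Sph m) (v w : tangent x) :
    ⟪radiiOp u x v, w⟫_ℝ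
      = ⟪sphGradDeriv u x (v : Eu m), (w : Eu m)⟫_ℝ + u x * ⟪(v : Eu m), (w : Eu m)⟫_ℝ := by
  simp only [radiiOp, sphHess, _root_.add_apply, inner_add_left,
    ContinuousLinearMap.comp_apply, _root_.smul_apply, ContinuousLinearMap.id_apply,
    inner_smul_left, conj_trivial, Submodule.coe_inner, Submodule.subtypeL_apply]
  congr 1
  rw [← Submodule.coe_inner]
  exact Submodule.inner_orthogonalProjectionOnto_eq_of_mem_right w _

lemma inner_tangent (x : Sph m) (v : tangent x) : ⟪(x : Eu m), (v : Eu m)⟫_ℝ = 0 :=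
  Submodule.mem_orthogonal_singleton_iff_inner_right.1 v.2

lemma inner_radiiOp_eq_dd_dd (hh : ContDiffOn ℝ ∞ h {0}ᶜ)
    (hu : ∀ y, y ≠ 0 → h y = ‖y‖ * radialExt u y) (x : Sph m) (v w : tangent x) :
    ⟪radiiOp u x v, w⟫_ℝ = dd (v : Eu m) (dd (w : Eu m) h) (x : Eu m) := by
  rw [inner_radiiOp, dd_dd_eq_inner_sphGradDeriv hh hu x (inner_tangent x v) (inner_tangent x w)]

lemma isSymmetric_radiiOp (hh : ContDiffOn ℝ ∞ h {0}ᶜ)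
    (hu : ∀ y, y ≠ 0 → h y = ‖y‖ * radialExt u y) (x : Sph m) :
    (radiiOp u x : tangent x →ₗ[ℝ] tangent x).IsSymmetric := by
  intro v w
  change ⟪radiiOp u x v, w⟫_ℝ = ⟪v, radiiOp u x w⟫_ℝ
  rw [real_inner_comm (radiiOp u x w) v, inner_radiiOp_eq_dd_dd hh hu, inner_radiiOp_eq_dd_dd hh hu]
  exact dd_comm isOpen_compl_singleton hh (sphere_ne_zero x) _ _

/-- The gradient of the homogeneous extension of degree one of `u`. -/
def fullGrad (u : Sph m → ℝ) (x : Sph m) : Eu m := u x • (x : Eu m) + sphGrad u x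

lemma inner_fullGrad (hh : ContDiffOn ℝ ∞ h {0}ᶜ)
    (hu : ∀ y, y ≠ 0 → h y = ‖y‖ * radialExt u y) (x : Sph m) (w : Eu m) :
    ⟪fullGrad u x, w⟫_ℝ = dd w h (x : Eu m) := by
  have hV : IsOpen ({0}ᶜ : Set (Eu m)) := isOpen_compl_singleton
  have hU := contDiffOn_radialExt hh hu
  have hx := sphere_ne_zero x
  have hx1 : ‖(x : Eu m)‖ = 1 := by simp
  have hux : radialExt u (x : Eu m) = u x := by rw [radialExt_eq_comp hx, sphereProj_coe]
  have h1 : EqOn h (fun y => ‖y‖ * radialExt u y) {0}ᶜ := fun z hz => hu z hz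
  have hn := dd_norm hx w
  rw [hx1, one_mul] at hn
  rw [dd_congr hV h1 hx, dd_mul (differentiableAt_of_contDiffOn hV contDiffOn_norm hx)
    (differentiableAt_of_contDiffOn hV hU hx), hn, hux, hx1, fullGrad, inner_add_left,
    inner_smul_left, sphGrad, inner_gradient]
  simp
  ring

/-- The quadratic form of `∇² u + u I` at `x`, evaluated on the tangential part of `ξ`. -/
def hessForm (u : Sph m → ℝ) (x : Sph m) (ξ : Eu m) : ℝ :=
  ⟪sphGradDeriv u x (ξ - ⟪(x : Eu m), ξ⟫_ℝ • (x : Eu m)), ξ - ⟪(x : Eu m), ξ⟫_ℝ • (x : Eu m)⟫_ℝ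
    + u x * ‖ξ - ⟪(x : Eu m), ξ⟫_ℝ • (x : Eu m)‖ ^ 2

/-- The tangential part of a vector. -/
def tangentPart (x : Sph m) (ξ : Eu m) : tangent x :=
  ⟨ξ - ⟪(x : Eu m), ξ⟫_ℝ • (x : Eu m), by
    rw [Submodule.mem_orthogonal_singleton_iff_inner_right, inner_sub_right, inner_smul_right,
      real_inner_self_eq_norm_sq]
    simp⟩

lemma norm_tangentPart_le (x : Sph m) (ξ : Eu m) : ‖tangentPart x ξ‖ ≤ ‖ξ‖ := by
  have hx1 : ‖(x : Eu m)‖ = 1 := by simp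
  refine le_of_sq_le_sq ?_ (norm_nonneg _)
  change ‖ξ - ⟪(x : Eu m), ξ⟫_ℝ • (x : Eu m)‖ ^ 2 ≤ _
  rw [norm_sub_sq_real, inner_smul_right, norm_smul, hx1, real_inner_comm, mul_one,
    Real.norm_eq_abs, sq_abs]
  nlinarith [sq_nonneg ⟪ξ, (x : Eu m)⟫_ℝ]

lemma hessForm_eq_inner_radiiOp (u : Sph m → ℝ) (x : Sph m) (ξ : Eu m) :
    hessForm u x ξ = ⟪radiiOp u x (tangentPart x ξ), tangentPart x ξ⟫_ℝ := by
  rw [inner_radiiOp, real_inner_self_eq_norm_sq]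
  rfl

end SphericalHessian

/-! ### Bounds on the sphere, radial invariance and orthonormal frames -/

lemma exists_bound_derivs {φ : Eu m → ℝ} (hφ : ContDiffOn ℝ ∞ φ {0}ᶜ) :
    ∃ C : ℝ, 0 ≤ C ∧ ∀ (x : Sph m) (w : Eu m), |φ x| ≤ C ∧ |dd w φ x| ≤ C * ‖w‖ ∧
      |dd w (dd w φ) x| ≤ C * ‖w‖ ^ 2 := by
  have hV : IsOpen ({0}ᶜ : Set (Eu m)) := isOpen_compl_singleton
  have h1 : ContDiffOn ℝ ∞ (fderiv ℝ φ) {0}ᶜ := hφ.fderiv_of_isOpen hV (m := ∞) (by simp)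
  have h2 : ContDiffOn ℝ ∞ (fderiv ℝ (fderiv ℝ φ)) {0}ᶜ :=
    h1.fderiv_of_isOpen hV (m := ∞) (by simp)
  have hS : sphere (0 : Eu m) 1 ⊆ {0}ᶜ := fun x hx => sphere_ne_zero ⟨x, hx⟩
  have hc : IsCompact (sphere (0 : Eu m) 1) := isCompact_sphere 0 1
  obtain ⟨C₀, hC₀⟩ := hc.exists_bound_of_continuousOn (hφ.continuousOn.mono hS)
  obtain ⟨C₁, hC₁⟩ := hc.exists_bound_of_continuousOn (h1.continuousOn.mono hS)
  have hc2 : ContinuousOn (fun y => ‖fderiv ℝ (fderiv ℝ φ) y‖) (sphere (0 : Eu m) 1) :=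
    (continuous_norm (E := Eu m →L[ℝ] Eu m →L[ℝ] ℝ)).comp_continuousOn (h2.continuousOn.mono hS)
  obtain ⟨C₂, hC₂⟩ := hc.exists_bound_of_continuousOn hc2
  refine ⟨max 0 (max C₀ (max C₁ C₂)), le_max_left _ _, fun x w => ⟨?_, ?_, ?_⟩⟩
  · exact (hC₀ x x.2).trans (by simp)
  · refine ((fderiv ℝ φ x).le_opNorm w).trans ?_
    exact mul_le_mul_of_nonneg_right ((hC₁ x x.2).trans (by simp)) (norm_nonneg w)
  · have hd : DifferentiableAt ℝ (fderiv ℝ φ) (x : Eu m) :=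
      (h1.contDiffAt (hV.mem_nhds (hS x.2))).differentiableAt (by simp)
    have : dd w (dd w φ) x = fderiv ℝ (fderiv ℝ φ) x w w := by
      change fderiv ℝ (fun q => fderiv ℝ φ q w) x w = _
      rw [fderiv_clm_apply hd (differentiableAt_const w)]
      simp
    rw [this, sq, ← mul_assoc]
    refine ((fderiv ℝ (fderiv ℝ φ) x).le_opNorm₂ w w).trans ?_
    have := (norm_norm (fderiv ℝ (fderiv ℝ φ) (x : Eu m))).symm.le.trans (hC₂ x x.2)
    have := this.trans (show C₂ ≤ max 0 (max C₀ (max C₁ C₂)) by simp)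
    gcongr

lemma supp_eq_norm_mul_radialExt (Ω : ConvexBody (Eu m)) (y : Eu m) (hy : y ≠ 0) :
    supp Ω y = ‖y‖ * radialExt (suppFn Ω) y := by
  rw [supp_eq_norm_mul Ω hy, radialExt_eq_comp hy]

lemma contDiffOn_supp {Ω : ConvexBody (Eu m)}
    (hΩ : ContMDiff (𝓡 m) 𝓘(ℝ, ℝ) ∞ (suppFn Ω)) : ContDiffOn ℝ ∞ (supp Ω) {0}ᶜ :=
  (contDiffOn_norm.mul (contDiffOn_comp_sphereProj hΩ)).congr fun _ hy => supp_eq_norm_mul Ω hy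

lemma abs_dd_supp_le (Ω : ConvexBody (Eu m)) (h0 : (0 : Eu m) ∈ Ω) (y w : Eu m) :
    |dd w (supp Ω) y| ≤ 2 * outerRadius Ω * ‖w‖ := by
  have hR : 0 ≤ 2 * outerRadius Ω := by linarith [outerRadius_nonneg Ω]
  have hL : LipschitzWith ⟨2 * outerRadius Ω, hR⟩ (supp Ω) := by
    refine LipschitzWith.of_dist_le_mul fun y z => ?_
    rw [Real.dist_eq, dist_eq_norm, abs_le]
    have h1 := supp_sub_le Ω h0 y z
    have h2 := supp_sub_le Ω h0 z y
    rw [norm_sub_rev] at h2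
    constructor
    · change -(2 * outerRadius Ω * _) ≤ _; linarith
    · exact h1
  refine ((fderiv ℝ (supp Ω) y).le_opNorm w).trans ?_
  exact mul_le_mul_of_nonneg_right (norm_fderiv_le_of_lipschitz ℝ hL) (norm_nonneg w)

lemma norm_fullGrad_le {Ω : ConvexBody (Eu m)} (hΩ : ContDiffOn ℝ ∞ (supp Ω) {0}ᶜ) (x : Sph m)
    {C : ℝ} (hC : ∀ w, |dd w (supp Ω) x| ≤ C * ‖w‖) : ‖fullGrad (suppFn Ω) x‖ ≤ C := by
  set V := fullGrad (suppFn Ω) x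
  have h1 := inner_fullGrad hΩ (supp_eq_norm_mul_radialExt Ω) x V
  rw [real_inner_self_eq_norm_sq] at h1
  have h2 := (le_abs_self _).trans (hC V)
  rw [← h1] at h2
  by_contra! h
  have h3 : 0 ≤ C := by
    by_contra! hneg
    have h4 := (abs_nonneg _).trans (hC (x : Eu m))
    simp at h4
    linarith
  nlinarith [norm_nonneg V]

/-- The Hessian of a function of degree one does not see radial components. -/
lemma dd_dd_add_radial {H : Eu m × ℝ → ℝ} (hH : ContDiffOn ℝ ∞ H (punctured (Eu m)))
    (hom : IsHom 1 H) {y : Eu m} {t : ℝ} (hy : y ≠ 0) (ht : 0 < t) (w : Eu m) (α β : ℝ) :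
    dd (α • w + β • y, (0 : ℝ)) (dd (α • w + β • y, (0 : ℝ)) H) (y, t)
      = α ^ 2 * dd (w, (0 : ℝ)) (dd (w, (0 : ℝ)) H) (y, t) := by
  have hU := isOpen_punctured (E := Eu m)
  have hyt : (y, t) ∈ punctured (Eu m) := ⟨hy, ht⟩
  have he : ∀ v : Eu m, dd (y, (0 : ℝ)) (dd (v, (0 : ℝ)) H) (y, t) = 0 := fun v => by
    have := (hom.dd_space hH v).euler (contDiffOn_dd hU hH _) hy ht
    simpa using this
  have hs : ((α • w + β • y, (0 : ℝ)) : Eu m × ℝ) = α • (w, (0 : ℝ)) + β • (y, (0 : ℝ)) := by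
    simp
  have h1 : ∀ G : Eu m × ℝ → ℝ, dd (α • w + β • y, (0 : ℝ)) G (y, t)
      = α * dd (w, (0 : ℝ)) G (y, t) + β * dd (y, (0 : ℝ)) G (y, t) := fun G => by
    rw [hs, dd_add_dir, dd_smul_dir, dd_smul_dir]
  rw [h1, he, dd_comm hU hH hyt, h1, he]
  ring

lemma finrank_tangent (x : Sph m) : Module.finrank ℝ (tangent x) = m := by
  have : Fact (Module.finrank ℝ (Eu m) = m + 1) := ⟨finrank_euclideanSpace_fin⟩
  exact Submodule.finrank_orthogonal_span_singleton (sphere_ne_zero x)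

lemma exists_orthonormalBasis_tangent (y : Sph m) {w : Fin m → Eu m} (hw : Orthonormal ℝ w)
    (hy : ∀ i, ⟪(y : Eu m), w i⟫_ℝ = 0) :
    ∃ b : OrthonormalBasis (Fin m) ℝ (tangent y), ∀ i, (b i : Eu m) = w i := by
  let v : Fin m → tangent y := fun i =>
    ⟨w i, Submodule.mem_orthogonal_singleton_iff_inner_right.2 (hy i)⟩
  have hv : Orthonormal ℝ v := by
    rw [orthonormal_iff_ite] at hw ⊢
    exact hw
  rcases isEmpty_or_nonempty (Fin m) with hm | hm
  · refine ⟨OrthonormalBasis.mk hv ?_, fun i => isEmptyElim i⟩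
    have : Module.finrank ℝ (tangent y) = 0 := by
      rw [finrank_tangent, ← Fintype.card_fin m, Fintype.card_eq_zero]
    have := Module.finrank_zero_iff.1 this
    exact fun z _ => by rw [Subsingleton.elim z 0]; exact Submodule.zero_mem _
  let B := basisOfOrthonormalOfCardEqFinrank hv (by rw [finrank_tangent, Fintype.card_fin])
  have hB : (B : Fin m → tangent y) = v := coe_basisOfOrthonormalOfCardEqFinrank _ _
  refine ⟨B.toOrthonormalBasis (by rw [hB]; exact hv), fun i => ?_⟩
  rw [Module.Basis.coe_toOrthonormalBasis, hB]

/-- Expresses |DH|² in a basis that stays fixed while the base point moves, so that it can be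
differentiated along lines. -/
lemma sum_inner_adjoin_sq (x : Sph m) {e : Fin m → Eu m} (he : Orthonormal ℝ e)
    (hx : ∀ i, ⟪(x : Eu m), e i⟫_ℝ = 0) (V : Eu m) :
    ∑ l, ⟪V, adjoin (x : Eu m) e l⟫_ℝ ^ 2 = ‖V‖ ^ 2 := by
  have ho : Orthonormal ℝ (adjoin (x : Eu m) e) := by
    rw [orthonormal_iff_ite] at he ⊢
    rintro (_ | i) (_ | j)
    · simp [adjoin]
    · simpa [adjoin] using hx j
    · simpa [adjoin, real_inner_comm] using hx i
    · simpa [adjoin] using he i j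
  let B := basisOfOrthonormalOfCardEqFinrank ho (by simp)
  have hB : (B : Option (Fin m) → Eu m) = adjoin (x : Eu m) e :=
    coe_basisOfOrthonormalOfCardEqFinrank _ _
  have := (B.toOrthonormalBasis (by rw [hB]; exact ho)).sum_sq_norm_inner_left V
  simpa [Module.Basis.coe_toOrthonormalBasis, hB] using this

/-! ### The flow in terms of the homogeneous extension -/

section Flow

variable {k : ℕ} {f : Sph m → ℝ} {K : ConvexBody (Eu m)} {Ω : ℝ → ConvexBody (Eu m)}

/-- The space-time support function of a family of convex bodies. -/
def stSupp (Ω : ℝ → ConvexBody (Eu m)) (p : Eu m × ℝ) : ℝ := supp (Ω p.2) p.1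

lemma IsFlow.contDiffOn (hΩ : IsFlow k f K Ω) :
    ContDiffOn ℝ ∞ (stSupp Ω) (punctured (Eu m)) := by
  have hn : ContDiffOn ℝ ∞ (fun p : Eu m × ℝ => ‖p.1‖) (punctured (Eu m)) :=
    contDiffOn_norm.comp contDiffOn_fst fun p hp => hp.1
  exact (hn.mul (contDiffOn_comp_sphereProj_prod hΩ.smooth)).congr
    fun p hp => supp_eq_norm_mul _ hp.1

lemma isHom_stSupp (Ω : ℝ → ConvexBody (Eu m)) : IsHom 1 (stSupp Ω) := fun c hc y t _ _ => by
  simpa [stSupp] using supp_smul_right (Ω t) hc.le y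

lemma IsFlow.contDiffOn_slice (hΩ : IsFlow k f K Ω) {t : ℝ} (ht : 0 < t) :
    ContDiffOn ℝ ∞ (supp (Ω t)) {0}ᶜ :=
  hΩ.contDiffOn.comp (g := stSupp Ω) (f := fun y : Eu m => (y, t))
    (contDiff_id.prodMk contDiff_const).contDiffOn fun _ hy => ⟨hy, ht⟩

lemma IsFlow.dd_space (hΩ : IsFlow k f K Ω) {y : Eu m} {t : ℝ} (hy : y ≠ 0) (ht : 0 < t)
    (v : Eu m) : dd (v, (0 : ℝ)) (stSupp Ω) (y, t) = dd v (supp (Ω t)) y :=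
  dd_slice hΩ.contDiffOn hy ht v

lemma IsFlow.dd_dd_space (hΩ : IsFlow k f K Ω) {y : Eu m} {t : ℝ} (hy : y ≠ 0) (ht : 0 < t)
    (v w : Eu m) : dd (v, (0 : ℝ)) (dd (w, (0 : ℝ)) (stSupp Ω)) (y, t)
      = dd v (dd w (supp (Ω t))) y := by
  rw [dd_slice (contDiffOn_dd isOpen_punctured hΩ.contDiffOn _) hy ht]
  exact dd_congr isOpen_compl_singleton (fun z hz => hΩ.dd_space hz ht w) hy v

lemma IsFlow.isSymmetric (hΩ : IsFlow k f K Ω) {t : ℝ} (ht : 0 < t) (x : Sph m) :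
    (radiiOp (suppFn (Ω t)) x : tangent x →ₗ[ℝ] tangent x).IsSymmetric :=
  isSymmetric_radiiOp (hΩ.contDiffOn_slice ht) (supp_eq_norm_mul_radialExt (Ω t)) x

lemma IsFlow.inner_radiiOp_eq (hΩ : IsFlow k f K Ω) {t : ℝ} (ht : 0 < t) (x : Sph m)
    (v w : tangent x) : ⟪radiiOp (suppFn (Ω t)) x v, w⟫_ℝ
      = dd ((v : Eu m), (0 : ℝ)) (dd ((w : Eu m), (0 : ℝ)) (stSupp Ω)) ((x : Eu m), t) := by
  rw [hΩ.dd_dd_space (sphere_ne_zero x) ht]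
  exact inner_radiiOp_eq_dd_dd (hΩ.contDiffOn_slice ht) (supp_eq_norm_mul_radialExt (Ω t)) x v w

lemma IsFlow.hessForm_eq (hΩ : IsFlow k f K Ω) {t : ℝ} (ht : 0 < t) (x : Sph m) (ξ : Eu m) :
    hessForm (suppFn (Ω t)) x ξ
      = dd (ξ, (0 : ℝ)) (dd (ξ, (0 : ℝ)) (stSupp Ω)) ((x : Eu m), t) := by
  rw [hessForm_eq_inner_radiiOp, hΩ.inner_radiiOp_eq ht]
  have : (tangentPart x ξ : Eu m) = (1 : ℝ) • ξ + (-⟪(x : Eu m), ξ⟫_ℝ) • (x : Eu m) := by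
    change ξ - ⟪(x : Eu m), ξ⟫_ℝ • (x : Eu m) = _
    module
  rw [this, dd_dd_add_radial hΩ.contDiffOn (isHom_stSupp Ω) (sphere_ne_zero x) ht]
  ring

lemma IsFlow.hessForm_nonneg (hΩ : IsFlow k f K Ω) {t : ℝ} (ht : 0 < t) (x : Sph m) (ξ : Eu m) :
    0 ≤ hessForm (suppFn (Ω t)) x ξ := by
  rw [hessForm_eq_inner_radiiOp]
  rcases eq_or_ne (tangentPart x ξ) 0 with h | h
  · simp [h]
  · exact (hΩ.posRadii t ht x _ h).le

lemma self_eq_norm_smul_sphereProj {y : Eu m} (hy : y ≠ 0) :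
    y = ‖y‖ • (sphereProj y : Eu m) := by
  rw [coe_sphereProj hy, smul_smul, mul_inv_cancel₀ (norm_ne_zero_iff.2 hy), one_smul]

lemma IsFlow.dd_dd_eq (hΩ : IsFlow k f K Ω) {y : Eu m} {t : ℝ} (hy : y ≠ 0) (ht : 0 < t)
    (ξ : Eu m) : dd (ξ, (0 : ℝ)) (dd (ξ, (0 : ℝ)) (stSupp Ω)) (y, t)
      = ‖y‖⁻¹ * hessForm (suppFn (Ω t)) (sphereProj y) ξ := by
  have hh := ((isHom_stSupp Ω).dd_space hΩ.contDiffOn ξ).dd_space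
    (contDiffOn_dd isOpen_punctured hΩ.contDiffOn _) ξ
  rw [hΩ.hessForm_eq ht]
  have := hh ‖y‖ (norm_pos_iff.2 hy) (sphereProj y) t (sphere_ne_zero _) ht
  rw [← self_eq_norm_smul_sphereProj hy] at this
  simpa using this

lemma IsFlow.dd_eq (hΩ : IsFlow k f K Ω) {y : Eu m} {t : ℝ} (hy : y ≠ 0) (ht : 0 < t)
    (w : Eu m) : dd (w, (0 : ℝ)) (stSupp Ω) (y, t)
      = ⟪fullGrad (suppFn (Ω t)) (sphereProj y), w⟫_ℝ := by
  have hh := (isHom_stSupp Ω).dd_space hΩ.contDiffOn w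
  have := hh ‖y‖ (norm_pos_iff.2 hy) (sphereProj y) t (sphere_ne_zero _) ht
  rw [← self_eq_norm_smul_sphereProj hy] at this
  rw [inner_fullGrad (hΩ.contDiffOn_slice ht) (supp_eq_norm_mul_radialExt (Ω t)),
    ← hΩ.dd_space (sphere_ne_zero _) ht]
  simpa using this

/-- The homogeneous extension of degree one of `log f`. -/
def logExt (f : Sph m → ℝ) (y : Eu m) : ℝ := ‖y‖ * Real.log (f (sphereProj y))

lemma contDiffOn_logExt (hf : ContMDiff (𝓡 m) 𝓘(ℝ, ℝ) ∞ f) (hfpos : ∀ x, 0 < f x) :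
    ContDiffOn ℝ ∞ (logExt f) {0}ᶜ :=
  contDiffOn_norm.mul ((contDiffOn_comp_sphereProj hf).log fun _ _ => (hfpos _).ne')

lemma IsFlow.sigmaK_pos (hk : k ≤ m) (hΩ : IsFlow k f K Ω) {t : ℝ} (ht : 0 < t) (x : Sph m) :
    0 < sigmaK k (suppFn (Ω t)) x := by
  rw [sigmaK, esymm_roots_charpoly (hΩ.isSymmetric ht x) (finrank_tangent x)]
  exact esym_pos (by simpa using hk) (eigenvalues_pos _ _ (hΩ.posRadii t ht x))

lemma IsFlow.dd_time (hk : k ≤ m) (hfpos : ∀ x, 0 < f x) (hΩ : IsFlow k f K Ω) {y : Eu m} {t : ℝ}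
    (hy : y ≠ 0) (ht : 0 < t) : dd ((0 : Eu m), (1 : ℝ)) (stSupp Ω) (y, t)
      = ‖y‖ * Real.log (sigmaK k (suppFn (Ω t)) (sphereProj y)) + logExt f y := by
  have h1 := hasDerivAt_line_zero (v := ((0 : Eu m), (1 : ℝ)))
    (differentiableAt_of_contDiffOn isOpen_punctured hΩ.contDiffOn (p := (y, t)) ⟨hy, ht⟩)
  have h2 := (hΩ.evol (sphereProj y) t ht).const_mul ‖y‖
  have h3 : HasDerivAt (fun s : ℝ => t + s) 1 0 := (hasDerivAt_id (0 : ℝ)).const_add t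
  have h4 := HasDerivAt.comp (0 : ℝ) (h₂ := fun s => ‖y‖ * suppFn (Ω s) (sphereProj y))
    (by simpa using h2) h3
  have h5 : (fun s : ℝ => stSupp Ω ((y, t) + s • ((0 : Eu m), (1 : ℝ))))
      = (fun s => ‖y‖ * suppFn (Ω s) (sphereProj y)) ∘ fun s : ℝ => t + s := by
    funext s
    simp [stSupp, supp_eq_norm_mul _ hy]
  rw [h5] at h1
  rw [h1.unique h4, mul_one, Real.log_mul (hΩ.sigmaK_pos hk ht _).ne' (hfpos _).ne', mul_add]
  rfl

end Flow

/-! ### The estimate of the largest principal radius -/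

section Estimates

variable {k : ℕ} {f : Sph m → ℝ} {K : ConvexBody (Eu m)} {Ω : ℝ → ConvexBody (Eu m)}

/-- The coefficients of the linearization of `log σ_{k+1}` at a diagonal matrix. -/
def logEsymGrad (k : ℕ) (lam : Fin m → ℝ) (i : Fin m) : ℝ :=
  esym (Finset.univ.erase i) k lam / esym Finset.univ (k + 1) lam

/-- Along a line orthogonal to `x₀`, the time derivative of the support function is bounded by the
linearization of the equation at the diagonal matrix with entries `lam`. -/
lemma IsFlow.dd_time_le (hk : k + 1 ≤ m) (hfpos : ∀ x, 0 < f x) (hΩ : IsFlow (k + 1) f K Ω)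
    {t : ℝ} (ht : 0 < t) (x₀ : Sph m) {e : Fin m → Eu m} (he : Orthonormal ℝ e)
    (hx : ∀ i, ⟪(x₀ : Eu m), e i⟫_ℝ = 0) {lam : Fin m → ℝ} (hlam : ∀ i, 0 < lam i) {c : ℝ}
    (hc : c = Real.log (esym Finset.univ (k + 1) lam) - (k + 1)) (l : Fin m) (s : ℝ) :
    dd ((0 : Eu m), (1 : ℝ)) (stSupp Ω) ((x₀ : Eu m) + s • e l, t) ≤
      c + max c 0 * s ^ 2 / 2 + logExt f ((x₀ : Eu m) + s • e l)
      + (1 + s ^ 2) * (∑ i, logEsymGrad k lam i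
        * dd (e i, (0 : ℝ)) (dd (e i, (0 : ℝ)) (stSupp Ω)) ((x₀ : Eu m) + s • e l, t))
      + s ^ 2 * (1 + s ^ 2) * (logEsymGrad k lam l
        * dd (e l, (0 : ℝ)) (dd (e l, (0 : ℝ)) (stSupp Ω)) ((x₀ : Eu m) + s • e l, t)) := by
  set p : Eu m := (x₀ : Eu m) + s • e l with hp_def
  have hxx : ⟪(x₀ : Eu m), (x₀ : Eu m)⟫_ℝ = 1 := by
    rw [real_inner_self_eq_norm_sq]; simp
  have hee := orthonormal_iff_ite.1 he
  have hx' : ∀ i, ⟪e i, (x₀ : Eu m)⟫_ℝ = 0 := fun i => by rw [real_inner_comm]; exact hx i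
  have hn2 : ‖p‖ ^ 2 = 1 + s ^ 2 := by
    rw [hp_def, norm_add_sq_real, inner_smul_right, hx, norm_smul, he.1 l]
    simp
  have hn : 0 < ‖p‖ := by
    by_contra! h
    have : ‖p‖ = 0 := le_antisymm h (norm_nonneg p)
    rw [this] at hn2
    nlinarith [sq_nonneg s]
  have hp : p ≠ 0 := norm_pos_iff.1 hn
  -- An orthonormal frame orthogonal to p, obtained by rotating e_l in the plane of x₀ and e_l and
  -- keeping the other vectors.
  let w : Fin m → Eu m := fun i => if i = l then ‖p‖⁻¹ • (e l - s • (x₀ : Eu m)) else e i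
  have hwl : w l = ‖p‖⁻¹ • (e l - s • (x₀ : Eu m)) := if_pos rfl
  have hwi : ∀ i, i ≠ l → w i = e i := fun i hi => if_neg hi
  have hw : Orthonormal ℝ w := by
    rw [orthonormal_iff_ite]
    intro i j
    by_cases hi : i = l <;> by_cases hj : j = l
    · subst hi; subst hj
      rw [hwl]
      simp only [inner_sub_left, inner_sub_right, inner_smul_left, inner_smul_right, hx, hx', hee,
        conj_trivial, hxx, if_true]
      field_simp
      rw [hn2]; ring
    · subst hi
      rw [hwl, hwi j hj, inner_smul_left, inner_sub_left, inner_smul_left, hx, hee]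
      simp [Ne.symm hj]
    · subst hj
      rw [hwl, hwi i hi, inner_smul_right, inner_sub_right, inner_smul_right, hx', hee]
      simp [hi]
    · rw [hwi i hi, hwi j hj, hee]
  have hwy : ∀ i, ⟪(sphereProj p : Eu m), w i⟫_ℝ = 0 := by
    intro i
    rw [coe_sphereProj hp, inner_smul_left, hp_def]
    by_cases hi : i = l
    · subst hi
      rw [hwl]
      simp only [inner_add_left, inner_sub_right, inner_smul_left, inner_smul_right, hx, hx', hee,
        hxx, conj_trivial, if_true]
      ring
    · rw [hwi i hi]
      simp [inner_add_left, inner_smul_left, hx, hee, Ne.symm hi]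
  obtain ⟨b, hb⟩ := exists_orthonormalBasis_tangent (sphereProj p) hw hwy
  set D : Eu m → ℝ := fun v => dd (v, (0 : ℝ)) (dd (v, (0 : ℝ)) (stSupp Ω)) (p, t) with hD
  -- Degree -1 of the Hessian gives the factor ‖p‖² = 1 + s². Since w_l equals ‖p‖ e_l up to a
  -- multiple of p, the entry i = l carries a second such factor, whose excess over 1 is the last
  -- term.
  have hquad : ∀ i, ‖p‖ * ⟪radiiOp (suppFn (Ω t)) (sphereProj p) (b i), b i⟫_ℝ
      = (1 + s ^ 2) * D (e i) + if i = l then s ^ 2 * (1 + s ^ 2) * D (e l) else 0 := by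
    intro i
    have h1 : ‖p‖ * ⟪radiiOp (suppFn (Ω t)) (sphereProj p) (b i), b i⟫_ℝ
        = (1 + s ^ 2) * D (w i) := by
      rw [hΩ.inner_radiiOp_eq ht, hb, ← hΩ.hessForm_eq ht, ← hn2, hD]
      simp only
      rw [hΩ.dd_dd_eq hp ht]
      field_simp
    rw [h1]
    by_cases hi : i = l
    · subst hi
      have h2 : w i = ‖p‖ • e i + (-(s * ‖p‖⁻¹)) • p := by
        have h3 : ‖p‖ = ‖p‖⁻¹ * (1 + s ^ 2) := by rw [← hn2]; field_simp
        have h5 : ‖p‖ • e i = (‖p‖⁻¹ * (1 + s ^ 2)) • e i := by rw [← h3]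
        rw [hwl, h5]
        conv_rhs => rw [show (-(s * ‖p‖⁻¹)) • p = (-(s * ‖p‖⁻¹)) • ((x₀ : Eu m) + s • e i) from rfl]
        module
      have h4 : D (w i) = ‖p‖ ^ 2 * D (e i) := by
        simp only [hD]
        rw [h2]
        exact dd_dd_add_radial hΩ.contDiffOn (isHom_stSupp Ω) hp ht _ _ _
      rw [h4, hn2, if_pos rfl]
      ring
    · rw [hwi i hi, if_neg hi, add_zero]
  have hlog := log_esymm_roots_charpoly_le (hΩ.isSymmetric ht (sphereProj p))
    (finrank_tangent _) (hΩ.posRadii t ht _) hk hlam b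
  have hlog' : Real.log (sigmaK (k + 1) (suppFn (Ω t)) (sphereProj p)) ≤ c
      + ∑ i, logEsymGrad k lam i
        * ⟪radiiOp (suppFn (Ω t)) (sphereProj p) (b i), b i⟫_ℝ := by
    refine hlog.trans_eq ?_
    rw [hc, Finset.sum_div]
    have : ∀ i, ⟪radiiOp (suppFn (Ω t)) (sphereProj p) (b i), b i⟫_ℝ
        * esym (Finset.univ.erase i) k lam / esym Finset.univ (k + 1) lam
        = logEsymGrad k lam i * ⟪radiiOp (suppFn (Ω t)) (sphereProj p) (b i), b i⟫_ℝ := fun i => by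
      rw [logEsymGrad]; ring
    simp only [← this, ContinuousLinearMap.coe_coe]
    ring
  have hsum : ‖p‖ * ∑ i, logEsymGrad k lam i
        * ⟪radiiOp (suppFn (Ω t)) (sphereProj p) (b i), b i⟫_ℝ
      = (1 + s ^ 2) * (∑ i, logEsymGrad k lam i * D (e i))
        + s ^ 2 * (1 + s ^ 2) * (logEsymGrad k lam l * D (e l)) := by
    have h1 : ∀ i, ‖p‖ * (logEsymGrad k lam i
        * ⟪radiiOp (suppFn (Ω t)) (sphereProj p) (b i), b i⟫_ℝ)
        = (1 + s ^ 2) * (logEsymGrad k lam i * D (e i))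
          + if i = l then s ^ 2 * (1 + s ^ 2) * (logEsymGrad k lam l * D (e l)) else 0 := fun i => by
      rw [mul_left_comm, hquad i]
      split_ifs with h
      · subst h; ring
      · ring
    rw [Finset.mul_sum, Finset.mul_sum, Finset.sum_congr rfl fun i _ => h1 i,
      Finset.sum_add_distrib]
    simp
  -- This is 1 ≤ ‖p‖ ≤ 1 + s²/2: the upper bound is used for c ≥ 0 and the lower bound for c ≤ 0.
  have hnc : ‖p‖ * c ≤ c + max c 0 * s ^ 2 / 2 := by
    have h1 : 1 ≤ ‖p‖ := by nlinarith [sq_nonneg s]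
    have h2 : ‖p‖ ≤ 1 + s ^ 2 / 2 := by nlinarith [sq_nonneg s, sq_nonneg (‖p‖ - 1)]
    rcases le_total c 0 with h | h
    · rw [max_eq_right h]; nlinarith
    · rw [max_eq_left h]; nlinarith
  rw [hΩ.dd_time hk hfpos hp ht]
  have := mul_le_mul_of_nonneg_left hlog' hn.le
  rw [mul_add, hsum] at this
  linarith

lemma sum_logEsymGrad_mul (hk : k + 1 ≤ m) {lam : Fin m → ℝ} (hlam : ∀ i, 0 < lam i) :
    ∑ i, logEsymGrad k lam i * lam i = k + 1 := by
  have h := sum_mul_esym_erase Finset.univ k lam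
  have hpos := esym_pos (s := (Finset.univ : Finset (Fin m))) (k := k + 1) (by simpa using hk) hlam
  have : ∀ i, logEsymGrad k lam i * lam i
      = lam i * esym (Finset.univ.erase i) k lam / esym Finset.univ (k + 1) lam := fun i => by
    rw [logEsymGrad]; ring
  rw [Finset.sum_congr rfl fun i _ => this i, ← Finset.sum_div, h, mul_div_assoc, div_self hpos.ne',
    mul_one]

lemma logEsymGrad_nonneg {lam : Fin m → ℝ} (hlam : ∀ i, 0 < lam i) (i : Fin m) :
    0 ≤ logEsymGrad k lam i := div_nonneg (esym_nonneg _ _ hlam) (esym_nonneg _ _ hlam)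

/-- The product F_j λ_j belonging to the largest eigenvalue is at least the average (k + 1)/m of all
F_i λ_i. This gives the coercive term of the maximum principle. -/
lemma le_mul_sum_logEsymGrad_mul_sq (hk : k + 1 ≤ m) {lam : Fin m → ℝ} (hlam : ∀ i, 0 < lam i)
    {j : Fin m} (hmax : ∀ i, lam i ≤ lam j) :
    lam j ≤ m * ∑ i, logEsymGrad k lam i * lam i ^ 2 := by
  have hpos := esym_pos (s := (Finset.univ : Finset (Fin m))) (k := k + 1) (by simpa using hk) hlam
  have h1 := esym_le_card_mul_max Finset.univ k hlam (Finset.mem_univ j) fun i _ => hmax i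
  have h2 : logEsymGrad k lam j * lam j ^ 2 ≤ ∑ i, logEsymGrad k lam i * lam i ^ 2 :=
    Finset.single_le_sum (f := fun i => logEsymGrad k lam i * lam i ^ 2)
      (fun i _ => mul_nonneg (logEsymGrad_nonneg hlam i) (sq_nonneg _)) (Finset.mem_univ j)
  have h3 : (k + 1 : ℝ) ≤ m * (logEsymGrad k lam j * lam j) := by
    rw [logEsymGrad, div_mul_eq_mul_div, ← mul_div_assoc, le_div_iff₀ hpos]
    simpa [mul_comm] using h1
  have h4 : lam j ≤ m * (logEsymGrad k lam j * lam j) * lam j := by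
    have : (1 : ℝ) ≤ m * (logEsymGrad k lam j * lam j) :=
      le_trans (by linarith [(Nat.cast_nonneg k : (0 : ℝ) ≤ k)]) h3
    nlinarith [hlam j]
  have h5 : (0 : ℝ) ≤ m := Nat.cast_nonneg m
  nlinarith [mul_le_mul_of_nonneg_left h2 h5]

lemma log_esym_le {lam : Fin m → ℝ} (hk : k ≤ m) (hlam : ∀ i, 0 < lam i) {M : ℝ}
    (hM : ∀ i, lam i ≤ M) (hM1 : 0 < M) :
    Real.log (esym Finset.univ k lam) ≤ Real.log (m.choose k) + k * Real.log M := by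
  have hpos := esym_pos (s := (Finset.univ : Finset (Fin m))) (by simpa using hk) hlam
  have h1 := esym_le_choose_mul_pow Finset.univ k hlam hM
  rw [Finset.card_univ, Fintype.card_fin] at h1
  have hch : (m.choose k : ℝ) ≠ 0 := by exact_mod_cast (Nat.choose_pos hk).ne'
  refine (Real.log_le_log hpos h1).trans_eq ?_
  rw [Real.log_mul hch (by positivity), Real.log_pow]

lemma inner_apply_self_le {V : Type*} [NormedAddCommGroup V] [InnerProductSpace ℝ V]
    [FiniteDimensional ℝ V] {T : V →ₗ[ℝ] V} (hT : T.IsSymmetric) {n : ℕ}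
    (hn : Module.finrank ℝ V = n) {M : ℝ} (hM : ∀ i, hT.eigenvalues hn i ≤ M) (v : V) :
    ⟪T v, v⟫_ℝ ≤ M * ‖v‖ ^ 2 := by
  rw [← (hT.eigenvectorBasis hn).sum_inner_mul_inner,
    ← (hT.eigenvectorBasis hn).sum_sq_norm_inner_right v, Finset.mul_sum]
  refine Finset.sum_le_sum fun i _ => ?_
  rw [hT, hT.apply_eigenvectorBasis, inner_smul_right, real_inner_comm _ v, Real.norm_eq_abs,
    sq_abs]
  simp only [RCLike.ofReal_real_eq_id, id]
  nlinarith [mul_le_mul_of_nonneg_right (hM i)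
    (sq_nonneg ⟪(hT.eigenvectorBasis hn) i, v⟫_ℝ)]

/-- The test function of the maximum principle. -/
def testFn (A : ℝ) (u : Sph m → ℝ) (x : Sph m) (ξ : Eu m) : ℝ :=
  hessForm u x ξ + A / 2 * ‖fullGrad u x‖ ^ 2

/-- At an interior space-time maximum of the test function, the largest principal radius `Λ`
satisfies an inequality of the form `A Λ ≤ C (1 + log Λ) (1 + A R₀)`. -/
lemma IsFlow.principal_radius_inequality (hk : k + 1 ≤ m)
    (hf : ContMDiff (𝓡 m) 𝓘(ℝ, ℝ) ∞ f) (hfpos : ∀ x, 0 < f x) (hΩ : IsFlow (k + 1) f K Ω)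
    {C : ℝ} (hC : ∀ (x : Sph m) (w : Eu m), |logExt f x| ≤ C ∧ |dd w (logExt f) x| ≤ C * ‖w‖ ∧
      |dd w (dd w (logExt f)) x| ≤ C * ‖w‖ ^ 2)
    {t₀ R₀ A : ℝ} (ht₀ : 0 < t₀) (hR : outerRadius (Ω t₀) ≤ R₀) (hA : 0 ≤ A) (x₀ : Sph m)
    {ξ₀ : Eu m} (hξ₀ : ‖ξ₀‖ = 1)
    (hmax : ∀ (x : Sph m) (t : ℝ) (ξ : Eu m), 0 < t → t ≤ t₀ → ‖ξ‖ = 1 →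
      testFn A (suppFn (Ω t)) x ξ ≤ testFn A (suppFn (Ω t₀)) x₀ ξ₀) :
    ∃ Λ : ℝ, hessForm (suppFn (Ω t₀)) x₀ ξ₀ ≤ Λ ∧ (1 ≤ Λ →
      A * Λ ≤ m * ((Real.log (m.choose (k + 1)) + (k + 1) * Real.log Λ + C + 4 * (k + 1))
        + A * (2 * R₀ * (Real.log (m.choose (k + 1)) + (k + 1) * Real.log Λ + C + 2 * (k + 1))
          + m * (2 * R₀ * C)))) := by
  have hT := hΩ.isSymmetric ht₀ x₀
  have hfr := finrank_tangent x₀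
  set lam := hT.eigenvalues hfr with hlam_def
  set b := hT.eigenvectorBasis hfr with hb_def
  have hlam : ∀ i, 0 < lam i := eigenvalues_pos hT hfr (hΩ.posRadii t₀ ht₀ x₀)
  have hne : Nonempty (Fin m) := ⟨⟨0, by omega⟩⟩
  obtain ⟨j, hj⟩ := Finite.exists_max lam
  let e : Fin m → Eu m := fun i => (b i : Eu m)
  have he : Orthonormal ℝ e := by
    have := b.orthonormal
    rw [orthonormal_iff_ite] at this ⊢
    exact this
  have hxe : ∀ i, ⟪(x₀ : Eu m), e i⟫_ℝ = 0 := fun i => inner_tangent x₀ (b i)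
  have hdiag : ∀ i i', dd (e i, (0 : ℝ)) (dd (e i', (0 : ℝ)) (stSupp Ω)) ((x₀ : Eu m), t₀)
      = if i = i' then lam i else 0 := by
    intro i i'
    rw [← hΩ.inner_radiiOp_eq ht₀]
    have h1 : radiiOp (suppFn (Ω t₀)) x₀ (b i) = lam i • b i := by
      have := hT.apply_eigenvectorBasis hfr i
      simp only [RCLike.ofReal_real_eq_id, id] at this
      exact this
    rw [h1, inner_smul_left, orthonormal_iff_ite.1 b.orthonormal]
    simp
  have hle : hessForm (suppFn (Ω t₀)) x₀ ξ₀ ≤ lam j := by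
    rw [hessForm_eq_inner_radiiOp]
    have h1 := inner_apply_self_le hT hfr hj (tangentPart x₀ ξ₀)
    have h2 := norm_tangentPart_le x₀ ξ₀
    rw [hξ₀] at h2
    refine h1.trans ?_
    have := hlam j
    have h3 : ‖tangentPart x₀ ξ₀‖ ^ 2 ≤ 1 := by nlinarith [norm_nonneg (tangentPart x₀ ξ₀)]
    nlinarith
  have hej : hessForm (suppFn (Ω t₀)) x₀ (e j) = lam j := by
    rw [hΩ.hessForm_eq ht₀, hdiag, if_pos rfl]
  have hej1 : ‖e j‖ = 1 := he.1 j
  -- The direction ξ₀ may be replaced by a top eigenvector, as this does not lower the test function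
  -- at (x₀, t₀). Kept constant in ℝⁿ, e_j is an admissible direction at every x, so no moving frame
  -- is needed.
  have hmax' : ∀ (x : Sph m) (t : ℝ), 0 < t → t ≤ t₀ →
      testFn A (suppFn (Ω t)) x (e j) ≤ testFn A (suppFn (Ω t₀)) x₀ (e j) := by
    intro x t ht htt
    refine (hmax x t (e j) ht htt hej1).trans ?_
    unfold testFn
    rw [hej]
    linarith
  let Q : Eu m × ℝ → ℝ := fun p => dd (e j, (0 : ℝ)) (dd (e j, (0 : ℝ)) (stSupp Ω)) p
      + A / 2 * ∑ l, dd (adjoin (x₀ : Eu m) e l, (0 : ℝ)) (stSupp Ω) p ^ 2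
  have hQval : ∀ (y : Eu m) (t : ℝ), y ≠ 0 → 0 < t → Q (y, t) = ‖y‖⁻¹
      * hessForm (suppFn (Ω t)) (sphereProj y) (e j)
      + A / 2 * ‖fullGrad (suppFn (Ω t)) (sphereProj y)‖ ^ 2 := by
    intro y t hy ht
    simp only [Q]
    rw [hΩ.dd_dd_eq hy ht, ← sum_inner_adjoin_sq x₀ he hxe]
    simp only [hΩ.dd_eq hy ht]
  have hQ₀ : Q ((x₀ : Eu m), t₀) = testFn A (suppFn (Ω t₀)) x₀ (e j) := by
    rw [hQval _ _ (sphere_ne_zero x₀) ht₀, sphereProj_coe, testFn]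
    simp
  -- The tangent lines at x₀ stay outside the open unit ball. There the factor ‖y‖⁻¹ only decreases
  -- the nonnegative Hessian term, and the gradient has degree zero, so a maximum over the sphere is
  -- one along these lines.
  have hQle : ∀ (y : Eu m) (t : ℝ), 1 ≤ ‖y‖ → 0 < t → t ≤ t₀ →
      Q (y, t) ≤ Q ((x₀ : Eu m), t₀) := by
    intro y t hy ht htt
    have hy0 : y ≠ 0 := by
      rintro rfl
      simp at hy
      linarith
    rw [hQ₀, hQval y t hy0 ht]
    refine le_trans ?_ (hmax' (sphereProj y) t ht htt)
    have := mul_le_of_le_one_left (hΩ.hessForm_nonneg ht (sphereProj y) (e j))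
      (inv_le_one_of_one_le₀ hy)
    unfold testFn
    linarith
  have hnorm : ∀ (i : Fin m) (s : ℝ), 1 ≤ ‖(x₀ : Eu m) + s • e i‖ := by
    intro i s
    have h1 : ⟪(x₀ : Eu m), (x₀ : Eu m) + s • e i⟫_ℝ = 1 := by
      rw [inner_add_right, inner_smul_right, hxe, real_inner_self_eq_norm_sq]; simp
    have h2 := real_inner_le_norm (x₀ : Eu m) ((x₀ : Eu m) + s • e i)
    rw [h1] at h2
    simpa using h2
  have hne0 : ∀ (i : Fin m) (s : ℝ), (x₀ : Eu m) + s • e i ≠ 0 := fun i s h => by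
    have := hnorm i s
    rw [h, norm_zero] at this
    linarith
  set c := Real.log (esym Finset.univ (k + 1) lam) - (k + 1) with hc
  have hFl := sum_logEsymGrad_mul hk hlam
  have hF := fun i => logEsymGrad_nonneg (k := k) hlam i
  have hx1 : ‖(x₀ : Eu m)‖ = 1 := by simp
  have htouch₀ : dd ((0 : Eu m), (1 : ℝ)) (stSupp Ω) ((x₀ : Eu m), t₀)
      = c + logExt f x₀ + (k + 1) := by
    rw [hΩ.dd_time hk hfpos (sphere_ne_zero x₀) ht₀, sphereProj_coe, hx1, one_mul, sigmaK,
      esymm_roots_charpoly hT hfr, ← hlam_def, hc]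
    ring
  have hineq := max_point_inequality (A := A) hΩ.contDiffOn (isHom_stSupp Ω)
    (contDiffOn_logExt hf hfpos) hne0 (sphere_ne_zero x₀) ht₀ hF hFl hdiag
    (hΩ.dd_time_le hk hfpos ht₀ x₀ he hxe hlam hc) htouch₀ (j := j) Q (fun p => rfl)
    (fun i s => hQle _ _ (hnorm i s) ht₀ le_rfl) (fun t ht htt => hQle _ _ hx1.ge ht htt)
  refine ⟨lam j, hle, fun hΛ => ?_⟩
  have h0mem : (0 : Eu m) ∈ Ω t₀ := interior_subset (hΩ.origin_mem t₀ ht₀)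
  have hRnn := outerRadius_nonneg (Ω t₀)
  have hC0 : 0 ≤ C := (abs_nonneg _).trans (hC x₀ 0).1
  have hlogΛ : 0 ≤ Real.log (lam j) := Real.log_nonneg hΛ
  have hch : 0 ≤ Real.log (m.choose (k + 1)) :=
    Real.log_nonneg (by exact_mod_cast Nat.choose_pos hk)
  have hkk : (0 : ℝ) ≤ k := Nat.cast_nonneg k
  set B : ℝ := Real.log (m.choose (k + 1)) + (k + 1) * Real.log (lam j) with hB
  have hB0 : 0 ≤ B := by positivity
  have hcB : c ≤ B := by
    have := log_esym_le hk hlam hj (hlam j)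
    push_cast at this
    linarith
  have hsub1 : max c 0 ≤ B := max_le hcB hB0
  have hsub2 : dd (e j) (dd (e j) (logExt f)) x₀ ≤ C := by
    have := (le_abs_self _).trans (hC x₀ (e j)).2.2
    rwa [hej1, one_pow, mul_one] at this
  have hsub3 : logEsymGrad k lam j * lam j ≤ k + 1 := by
    rw [← hFl]
    exact Finset.single_le_sum (f := fun i => logEsymGrad k lam i * lam i)
      (fun i _ => mul_nonneg (hF i) (hlam i).le) (Finset.mem_univ j)
  have hsub4 : stSupp Ω ((x₀ : Eu m), t₀) * (c + logExt f x₀ + 2 * (k + 1))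
      ≤ 2 * R₀ * (B + C + 2 * (k + 1)) := by
    obtain ⟨h1, h2⟩ := abs_supp_le (Ω t₀) h0mem (x₀ : Eu m)
    rw [hx1, mul_one] at h2
    have h3 := (le_abs_self _).trans (hC x₀ 0).1
    have h4 : c + logExt f x₀ + 2 * (k + 1) ≤ B + C + 2 * (k + 1) := by linarith
    refine (mul_le_mul_of_nonneg_left h4 h1).trans ?_
    refine mul_le_mul_of_nonneg_right ?_ (by positivity)
    change supp (Ω t₀) x₀ ≤ _
    linarith
  have hsub5 : ∑ l, dd (e l, (0 : ℝ)) (stSupp Ω) ((x₀ : Eu m), t₀) * dd (e l) (logExt f) x₀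
      ≤ m * (2 * R₀ * C) := by
    have : ∀ l ∈ Finset.univ, dd (e l, (0 : ℝ)) (stSupp Ω) ((x₀ : Eu m), t₀)
        * dd (e l) (logExt f) x₀ ≤ 2 * R₀ * C := by
      intro l _
      have hel : ‖e l‖ = 1 := he.1 l
      rw [hΩ.dd_space (sphere_ne_zero x₀) ht₀]
      have h1 := abs_dd_supp_le (Ω t₀) h0mem (x₀ : Eu m) (e l)
      have h2 := (hC x₀ (e l)).2.1
      rw [hel, mul_one] at h1 h2
      refine (le_abs_self _).trans ?_
      rw [abs_mul]
      exact mul_le_mul (h1.trans (by linarith)) h2 (abs_nonneg _) (by linarith)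
    simpa using Finset.sum_le_card_nsmul _ _ _ this
  have hsub6 := le_mul_sum_logEsymGrad_mul_sq hk hlam hj
  set G := ∑ i, logEsymGrad k lam i * lam i ^ 2
  have h7 : A * G ≤ (B + C + 4 * (k + 1)) + A * (2 * R₀ * (B + C + 2 * (k + 1))
      + m * (2 * R₀ * C)) := by
    have := mul_le_mul_of_nonneg_left (add_le_add hsub4 hsub5) hA
    rw [mul_sub] at hineq
    linarith
  calc A * lam j ≤ A * (m * G) := mul_le_mul_of_nonneg_left hsub6 hA
    _ = m * (A * G) := by ring
    _ ≤ _ := mul_le_mul_of_nonneg_left h7 (Nat.cast_nonneg m)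

end Estimates

/-! ### Absorbing the logarithm -/

/-- With z = x^{1/3} one has log x ≤ 3z, hence z³ ≤ D(1 + 3z) ≤ 4Dz and z² ≤ 4D. -/
lemma le_of_le_mul_one_add_log {x D : ℝ} (hx : 1 ≤ x) (hD : 0 ≤ D)
    (h : x ≤ D * (1 + Real.log x)) : x ≤ Real.sqrt ((4 * D) ^ 3) := by
  set z := x ^ (1 / 3 : ℝ) with hz
  have hz1 : 1 ≤ z := Real.one_le_rpow hx (by norm_num)
  have hz3 : z ^ 3 = x := by
    rw [hz, ← Real.rpow_natCast, ← Real.rpow_mul (by linarith)]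
    norm_num
  have hlog : Real.log x ≤ 3 * z := by
    have := Real.log_le_rpow_div (x := x) (by linarith) (show (0 : ℝ) < 1 / 3 by norm_num)
    rw [← hz] at this
    linarith
  have h1 : z ^ 3 ≤ 4 * D * z := by
    rw [hz3]
    nlinarith
  have h2 : z ^ 2 ≤ 4 * D := by
    have : z ^ 2 * z ≤ 4 * D * z := by linarith [h1, show z ^ 2 * z = z ^ 3 by ring]
    exact le_of_mul_le_mul_right this (by linarith)
  refine Real.le_sqrt_of_sq_le ?_
  calc x ^ 2 = (z ^ 2) ^ 3 := by rw [← hz3]; ring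
    _ ≤ (4 * D) ^ 3 := pow_le_pow_left₀ (sq_nonneg z) h2 3

/-- Multiplication by √(1 + R) leaves x ≤ D (1 + R)(1 + log x), because √(1 + R) ≤ 1 + R; the
previous lemma turns the factor 1 + R into (1 + R)^{3/2}. -/
lemma le_of_inv_sqrt_mul_le {x n B C κ R : ℝ} (hx : 1 ≤ x) (hn : 0 ≤ n) (hB : 0 ≤ B) (hC : 0 ≤ C)
    (hκ : 0 ≤ κ) (hR : 0 ≤ R)
    (h : (Real.sqrt (1 + R))⁻¹ * x ≤ n * ((B + κ * Real.log x + C + 4 * κ)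
      + (Real.sqrt (1 + R))⁻¹ * (2 * R * (B + κ * Real.log x + C + 2 * κ) + n * (2 * R * C)))) :
    x ≤ Real.sqrt ((4 * (n * (3 * (B + C + 4 * κ) + 2 * n * C))) ^ 3)
      * ((1 + R) * Real.sqrt (1 + R)) := by
  set L := Real.log x
  have hL : 0 ≤ L := Real.log_nonneg hx
  set S : ℝ := 1 + R with hS
  set q : ℝ := Real.sqrt S
  have hq2 : q * q = S := Real.mul_self_sqrt (by linarith)
  have hq1 : 1 ≤ q := Real.one_le_sqrt.2 (by linarith)
  have hqS : q ≤ S := by nlinarith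
  set P : ℝ := B + C + 4 * κ with hP
  have hP0 : 0 ≤ P := by positivity
  set D : ℝ := n * (3 * P + 2 * n * C) with hD
  have hD0 : 0 ≤ D := by positivity
  set Y := B + κ * L + C + 4 * κ with hY
  have hYP : Y ≤ P * (1 + L) := by
    simp only [hY, hP]
    nlinarith [mul_nonneg hB hL, mul_nonneg hC hL, mul_nonneg hκ hL]
  have hY0 : 0 ≤ Y := by positivity
  have h1 : x ≤ n * (q * Y + (2 * R * Y + n * (2 * R * C))) := by
    have h2 : q⁻¹ * x ≤ n * (Y + q⁻¹ * (2 * R * Y + n * (2 * R * C))) := by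
      refine h.trans ?_
      have : B + κ * L + C + 2 * κ ≤ Y := by linarith
      gcongr
    rw [inv_mul_le_iff₀ (by linarith)] at h2
    refine h2.trans_eq ?_
    field_simp
  have h3 : x ≤ D * S * (1 + L) := by
    refine h1.trans ?_
    have h4 : q * Y ≤ S * (P * (1 + L)) := mul_le_mul hqS hYP hY0 (by linarith)
    have h5 : R * Y ≤ S * (P * (1 + L)) := mul_le_mul (by linarith) hYP hY0 (by linarith)
    have h6 : R * C ≤ S * (C * (1 + L)) :=
      mul_le_mul (by linarith) (le_mul_of_one_le_right hC (by linarith)) hC (by linarith)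
    have h7 := mul_le_mul_of_nonneg_left h6 hn
    have h8 : q * Y + (2 * R * Y + n * (2 * R * C))
        ≤ (3 * P + 2 * n * C) * (S * (1 + L)) := by linarith
    calc _ ≤ n * ((3 * P + 2 * n * C) * (S * (1 + L))) := mul_le_mul_of_nonneg_left h8 hn
      _ = _ := by rw [hD]; ring
  have h8 := le_of_le_mul_one_add_log hx (mul_nonneg hD0 (by linarith)) h3
  have h9 : (4 * (D * S)) ^ 3 = (4 * D) ^ 3 * (S * q) ^ 2 := by
    rw [mul_pow S q, sq q, hq2]; ring
  rwa [h9, Real.sqrt_mul (by positivity), Real.sqrt_sq (mul_nonneg (by linarith) (by linarith))]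
    at h8

/-! ### Existence of the maximum and the initial time -/

section Flow

variable {k : ℕ} {f : Sph m → ℝ} {K : ConvexBody (Eu m)} {Ω : ℝ → ConvexBody (Eu m)}

lemma IsFlow.continuousOn_testFn (hΩ : IsFlow k f K Ω) (A : ℝ) {S : Set ((Sph m × ℝ) × Eu m)}
    (hS : ∀ z ∈ S, 0 ≤ z.1.2) :
    ContinuousOn (fun z : (Sph m × ℝ) × Eu m => testFn A (suppFn (Ω z.1.2)) z.1.1 z.2) S := by
  have hfst : ContinuousOn (fun z : (Sph m × ℝ) × Eu m => z.1) S := continuous_fst.continuousOn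
  have hmaps : MapsTo (fun z : (Sph m × ℝ) × Eu m => z.1) S (univ ×ˢ Ici 0) :=
    fun z hz => mk_mem_prod (mem_univ _) (hS z hz)
  have hu : ContinuousOn (fun z : (Sph m × ℝ) × Eu m => suppFn (Ω z.1.2) z.1.1) S :=
    hΩ.cont.comp hfst hmaps
  have hg : ContinuousOn (fun z : (Sph m × ℝ) × Eu m => sphGrad (suppFn (Ω z.1.2)) z.1.1) S :=
    hΩ.cont_grad.comp hfst hmaps
  have hh : ContinuousOn (fun z : (Sph m × ℝ) × Eu m => sphGradDeriv (suppFn (Ω z.1.2)) z.1.1)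
      S := hΩ.cont_hess.comp hfst hmaps
  have hx : ContinuousOn (fun z : (Sph m × ℝ) × Eu m => (z.1.1 : Eu m)) S :=
    (continuous_subtype_val.comp (continuous_fst.comp continuous_fst)).continuousOn
  have hξ : ContinuousOn (fun z : (Sph m × ℝ) × Eu m => z.2) S := continuous_snd.continuousOn
  have hi : ContinuousOn (fun z : (Sph m × ℝ) × Eu m => ⟪(z.1.1 : Eu m), z.2⟫_ℝ) S := hx.inner hξ
  have hv : ContinuousOn (fun z : (Sph m × ℝ) × Eu m =>
      z.2 - ⟪(z.1.1 : Eu m), z.2⟫_ℝ • (z.1.1 : Eu m)) S := hξ.sub (hi.smul hx)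
  have hq : ContinuousOn (fun z : (Sph m × ℝ) × Eu m =>
      ⟪sphGradDeriv (suppFn (Ω z.1.2)) z.1.1 (z.2 - ⟪(z.1.1 : Eu m), z.2⟫_ℝ • (z.1.1 : Eu m)),
        z.2 - ⟪(z.1.1 : Eu m), z.2⟫_ℝ • (z.1.1 : Eu m)⟫_ℝ) S := (hh.clm_apply hv).inner hv
  unfold testFn hessForm fullGrad
  exact (hq.add (hu.mul (hv.norm.pow 2))).add
    (continuousOn_const.mul (((hu.smul hx).add hg).norm.pow 2))

/-- Compactness requires the time 0, which is where the C² continuity of the solution up to t = 0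
enters. -/
lemma IsFlow.exists_max_testFn (hΩ : IsFlow k f K Ω) (A : ℝ) {t : ℝ} (ht : 0 < t) :
    ∃ (x₀ : Sph m) (t₀ : ℝ) (ξ₀ : Eu m), 0 ≤ t₀ ∧ t₀ ≤ t ∧ ‖ξ₀‖ = 1 ∧
      ∀ (x : Sph m) (τ : ℝ) (ξ : Eu m), 0 ≤ τ → τ ≤ t → ‖ξ‖ = 1 →
        testFn A (suppFn (Ω τ)) x ξ ≤ testFn A (suppFn (Ω t₀)) x₀ ξ₀ := by
  have hS : IsCompact (((univ : Set (Sph m)) ×ˢ Icc (0 : ℝ) t) ×ˢ sphere (0 : Eu m) 1) :=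
    (isCompact_univ.prod isCompact_Icc).prod (isCompact_sphere 0 1)
  obtain ⟨z, hz, hmax⟩ := hS.exists_isMaxOn
    ⟨((sphereProj 0, 0), (sphereProj 0 : Sph m).1),
      mk_mem_prod (mk_mem_prod (mem_univ _) (left_mem_Icc.2 ht.le)) (sphereProj 0).2⟩
    (hΩ.continuousOn_testFn A fun z hz => (mem_prod.1 (mem_prod.1 hz).1).2.1)
  have hz1 := (mem_prod.1 (mem_prod.1 hz).1).2
  refine ⟨z.1.1, z.1.2, z.2, hz1.1, hz1.2, mem_sphere_zero_iff_norm.1 (mem_prod.1 hz).2,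
    fun x τ ξ h0 h1 h2 => ?_⟩
  have hmem : ((x, τ), ξ) ∈ ((univ : Set (Sph m)) ×ˢ Icc (0 : ℝ) t) ×ˢ sphere (0 : Eu m) 1 :=
    mk_mem_prod (mk_mem_prod (mem_univ _) (mem_Icc.2 ⟨h0, h1⟩)) (mem_sphere_zero_iff_norm.2 h2)
  have := isMaxOn_iff.1 hmax _ hmem
  exact this

/-- The bound R₀ concerns positive times only and is carried to t = 0 by continuity. It controls the
scale θ of the initial body. -/
lemma IsFlow.suppFn_zero_le (hΩ : IsFlow k f K Ω) {R₀ : ℝ}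
    (hR : ∀ t, 0 < t → outerRadius (Ω t) ≤ R₀) (x : Sph m) : suppFn K x ≤ 2 * R₀ := by
  have hc : ContinuousWithinAt (fun t : ℝ => suppFn (Ω t) x) (Ioi 0) 0 := by
    have h1 : ContinuousWithinAt (fun p : Sph m × ℝ => suppFn (Ω p.2) p.1) (univ ×ˢ Ici 0) (x, 0) :=
      hΩ.cont _ ⟨mem_univ _, self_mem_Ici⟩
    exact h1.comp (f := fun t : ℝ => ((x, t) : Sph m × ℝ)) (t := univ ×ˢ Ici 0)
      (by fun_prop) fun t ht => ⟨mem_univ _, (show (0 : ℝ) < t from ht).le⟩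
  have h2 := hc.tendsto
  rw [hΩ.init] at h2
  refine le_of_tendsto h2 ?_
  filter_upwards [self_mem_nhdsWithin] with t ht
  have h3 := (abs_supp_le (Ω t) (interior_subset (hΩ.origin_mem t ht)) (x : Eu m)).2
  have h4 : ‖(x : Eu m)‖ = 1 := by simp
  rw [h4, mul_one] at h3
  exact h3.trans (by linarith [hR t ht])

end Flow

lemma suppFn_pos {Ω : ConvexBody (Eu m)} (h0 : (0 : Eu m) ∈ interior (Ω : Set (Eu m)))
    (x : Sph m) : 0 < suppFn Ω x := by
  obtain ⟨ε, hε, hball⟩ := Metric.isOpen_iff.1 isOpen_interior 0 h0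
  have hx1 : ‖(x : Eu m)‖ = 1 := by simp
  have hmem : (ε / 2) • (x : Eu m) ∈ Ω := by
    refine interior_subset (hball ?_)
    rw [mem_ball_zero_iff, norm_smul, hx1, Real.norm_of_nonneg (by positivity)]
    linarith
  have := inner_le_supp Ω (x : Eu m) hmem
  rw [inner_smul_right, real_inner_self_eq_norm_sq, hx1] at this
  rw [suppFn_eq_supp]
  linarith

/-- Bound on the test function at the initial time, linear in the scale `θ`. -/
lemma exists_bound_initial {Ω₀ : ConvexBody (Eu m)}
    (hΩ₀ : ContMDiff (𝓡 m) 𝓘(ℝ, ℝ) ∞ (suppFn Ω₀)) :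
    ∃ W : ℝ, 0 ≤ W ∧ ∀ θ : ℝ, 0 < θ → ∀ (x : Sph m) (ξ : Eu m), ‖ξ‖ = 1 →
      hessForm (suppFn (θ • Ω₀)) x ξ ≤ θ * W ∧ ‖fullGrad (suppFn (θ • Ω₀)) x‖ ≤ θ * W := by
  have h0 := contDiffOn_supp hΩ₀
  have hV : IsOpen ({0}ᶜ : Set (Eu m)) := isOpen_compl_singleton
  obtain ⟨W, hW0, hW⟩ := exists_bound_derivs h0
  refine ⟨W, hW0, fun θ hθ x ξ hξ => ?_⟩
  have hx := sphere_ne_zero x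
  have hs : supp (θ • Ω₀) = θ • supp Ω₀ := funext fun y => supp_smul_left Ω₀ hθ.le y
  have hsm : ContDiffOn ℝ ∞ (supp (θ • Ω₀)) {0}ᶜ := by
    rw [hs]; exact contDiffOn_const.smul h0
  have hd1 : ∀ w (y : Eu m), dd w (supp (θ • Ω₀)) y = θ * dd w (supp Ω₀) y := by
    intro w y
    rw [hs, dd, fderiv_const_smul_field]
    rfl
  have hd2 : ∀ w (y : Eu m), dd w (dd w (supp (θ • Ω₀))) y = θ * dd w (dd w (supp Ω₀)) y := by
    intro w y
    have : dd w (supp (θ • Ω₀)) = θ • dd w (supp Ω₀) := funext fun y => hd1 w y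
    rw [this, dd, fderiv_const_smul_field]
    rfl
  constructor
  · rw [hessForm_eq_inner_radiiOp,
      inner_radiiOp_eq_dd_dd hsm (supp_eq_norm_mul_radialExt _), hd2]
    refine mul_le_mul_of_nonneg_left ?_ hθ.le
    refine (le_abs_self _).trans ((hW x _).2.2.trans ?_)
    have h1 := norm_tangentPart_le x ξ
    rw [hξ] at h1
    have h2 : ‖((tangentPart x ξ : tangent x) : Eu m)‖ ≤ 1 := h1
    have h3 : ‖((tangentPart x ξ : tangent x) : Eu m)‖ ^ 2 ≤ 1 := by
      nlinarith [norm_nonneg ((tangentPart x ξ : tangent x) : Eu m)]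
    nlinarith
  · refine norm_fullGrad_le hsm x fun w => ?_
    rw [hd1, abs_mul, abs_of_pos hθ, mul_assoc]
    exact mul_le_mul_of_nonneg_left (hW x w).2.1 hθ.le

variable {k : ℕ} {f : Sph m → ℝ}

/-- The principal radii of curvature of a solution are at most `C (1 + R₀)^{3/2}`. -/
lemma exists_hessForm_bound (hk : k + 1 ≤ m) (hf : ContMDiff (𝓡 m) 𝓘(ℝ, ℝ) ∞ f)
    (hfpos : ∀ x, 0 < f x) {Ω₀ : ConvexBody (Eu m)}
    (hΩ₀ : ContMDiff (𝓡 m) 𝓘(ℝ, ℝ) ∞ (suppFn Ω₀))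
    (h0 : (0 : Eu m) ∈ interior (Ω₀ : Set (Eu m))) :
    ∃ M : ℝ, 1 ≤ M ∧ ∀ θ : ℝ, 0 < θ → ∀ Ω : ℝ → ConvexBody (Eu m),
      IsFlow (k + 1) f (θ • Ω₀) Ω → ∀ R₀ : ℝ, (∀ t, 0 < t → outerRadius (Ω t) ≤ R₀) →
      ∀ t, 0 < t → ∀ (x : Sph m) (ξ : Eu m), ‖ξ‖ = 1 →
        hessForm (suppFn (Ω t)) x ξ ≤ M * ((1 + R₀) * Real.sqrt (1 + R₀)) := by
  obtain ⟨C, hC0, hC⟩ := exists_bound_derivs (contDiffOn_logExt hf hfpos)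
  obtain ⟨W, hW0, hW⟩ := exists_bound_initial hΩ₀
  set x₁ : Sph m := sphereProj 0
  -- Chosen so that θ h₀(x₁) ≤ 2R₀ becomes θ ≤ c₁ R₀ at one fixed point x₁; this removes θ from the
  -- final constant.
  set c₁ : ℝ := 2 / suppFn Ω₀ x₁ with hc₁
  have hs := suppFn_pos h0 x₁
  have hc₁0 : 0 < c₁ := by positivity
  set B : ℝ := Real.log (m.choose (k + 1)) with hB
  have hB0 : 0 ≤ B := Real.log_nonneg (by exact_mod_cast Nat.choose_pos hk)
  have hk0 : (0 : ℝ) ≤ k := Nat.cast_nonneg k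
  have hm0 : (0 : ℝ) ≤ m := Nat.cast_nonneg m
  set P : ℝ := B + C + 4 * (k + 1) with hP
  have hP0 : 0 ≤ P := by positivity
  set D : ℝ := m * (3 * P + 2 * m * C) with hD
  have hD0 : 0 ≤ D := by positivity
  -- The three summands account for Λ ≤ 1, for the bound when Λ ≥ 1, and for the gradient term; `M₂`
  -- serves a maximum at time 0.
  set M₁ : ℝ := 1 + Real.sqrt ((4 * D) ^ 3) + 2 with hM₁
  set M₂ : ℝ := c₁ * W + (c₁ * W) ^ 2 with hM₂
  have hM₁1 : 1 ≤ M₁ := by have := Real.sqrt_nonneg ((4 * D) ^ 3); linarith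
  have hM₂0 : 0 ≤ M₂ := by positivity
  refine ⟨M₁ + M₂, by linarith, fun θ hθ Ω hΩ R₀ hR t ht x ξ hξ => ?_⟩
  have hR0 : 0 ≤ R₀ := (outerRadius_nonneg _).trans (hR t ht)
  set S : ℝ := 1 + R₀ with hS
  set q : ℝ := Real.sqrt S with hq
  have hq2 : q * q = S := Real.mul_self_sqrt (by linarith)
  have hq1 : 1 ≤ q := Real.one_le_sqrt.2 (by linarith)
  have hS1 : 1 ≤ S := by linarith
  have hSq : S ≤ S * q := by nlinarith
  -- With A = q⁻¹ = (1 + R₀)^{-1/2} the gradient term, of size A R₀², has the order (1 + R₀)^{3/2}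
  -- of the final bound.
  have hR2 : q⁻¹ * R₀ ^ 2 ≤ S * q := by
    rw [inv_mul_le_iff₀ (by linarith)]
    have h1 : R₀ ^ 2 ≤ S ^ 2 := pow_le_pow_left₀ hR0 (by linarith) 2
    calc R₀ ^ 2 ≤ S ^ 2 := h1
      _ = q * (S * q) := by nlinarith
  have hA : 0 ≤ q⁻¹ := by positivity
  obtain ⟨x₀, t₀, ξ₀, ht₀, htt, hξ₀, hmax⟩ := hΩ.exists_max_testFn q⁻¹ ht
  have hle : hessForm (suppFn (Ω t)) x ξ ≤ testFn q⁻¹ (suppFn (Ω t₀)) x₀ ξ₀ := by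
    refine le_trans ?_ (hmax x t ξ ht.le le_rfl hξ)
    unfold testFn
    have : 0 ≤ q⁻¹ / 2 * ‖fullGrad (suppFn (Ω t)) x‖ ^ 2 := by positivity
    linarith
  refine hle.trans ?_
  rcases ht₀.eq_or_lt with rfl | ht₀
  · have hθR : θ ≤ c₁ * R₀ := by
      have h1 := hΩ.suppFn_zero_le hR x₁
      rw [suppFn_eq_supp, supp_smul_left Ω₀ hθ.le, ← suppFn_eq_supp] at h1
      rw [hc₁, div_mul_eq_mul_div, le_div_iff₀ hs]
      exact h1
    rw [hΩ.init]
    obtain ⟨h1, h2⟩ := hW θ hθ x₀ ξ₀ hξ₀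
    have h3 : θ * W ≤ c₁ * W * R₀ := by nlinarith
    have h4 : ‖fullGrad (suppFn (θ • Ω₀)) x₀‖ ^ 2 ≤ (c₁ * W) ^ 2 * R₀ ^ 2 := by
      rw [← mul_pow]
      exact pow_le_pow_left₀ (norm_nonneg _) (h2.trans h3) 2
    unfold testFn
    have h5 : q⁻¹ / 2 * ‖fullGrad (suppFn (θ • Ω₀)) x₀‖ ^ 2 ≤ (c₁ * W) ^ 2 * (S * q) := by
      calc q⁻¹ / 2 * ‖fullGrad (suppFn (θ • Ω₀)) x₀‖ ^ 2
          ≤ q⁻¹ / 2 * ((c₁ * W) ^ 2 * R₀ ^ 2) := mul_le_mul_of_nonneg_left h4 (by positivity)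
        _ = (c₁ * W) ^ 2 * (q⁻¹ * R₀ ^ 2) / 2 := by ring
        _ ≤ (c₁ * W) ^ 2 * (q⁻¹ * R₀ ^ 2) := half_le_self (by positivity)
        _ ≤ _ := mul_le_mul_of_nonneg_left hR2 (by positivity)
    have h6 : c₁ * W * R₀ ≤ c₁ * W * (S * q) :=
      mul_le_mul_of_nonneg_left (by linarith) (by positivity)
    have h7 : 0 ≤ M₁ * (S * q) := by positivity
    rw [add_mul, hM₂, add_mul]
    linarith
  · obtain ⟨Λ, hΛ, hineq⟩ := hΩ.principal_radius_inequality hk hf hfpos hC ht₀ (hR t₀ ht₀) hA x₀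
      hξ₀ fun x τ ξ hτ hττ hξ => hmax x τ ξ hτ.le (hττ.trans htt) hξ
    have hΛS : Λ ≤ (1 + Real.sqrt ((4 * D) ^ 3)) * (S * q) := by
      have hsq := mul_nonneg (Real.sqrt_nonneg ((4 * D) ^ 3)) (show 0 ≤ S * q by linarith)
      rw [add_mul, one_mul]
      rcases le_total Λ 1 with h | h
      · linarith
      · have := le_of_inv_sqrt_mul_le h hm0 hB0 hC0 (show (0 : ℝ) ≤ k + 1 by linarith) hR0
          (hineq h)
        rw [← hS, ← hq, ← hP, ← hD] at this
        linarith
    have hG : ‖fullGrad (suppFn (Ω t₀)) x₀‖ ≤ 2 * R₀ := by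
      refine norm_fullGrad_le (hΩ.contDiffOn_slice ht₀) x₀ fun w => ?_
      refine (abs_dd_supp_le (Ω t₀) (interior_subset (hΩ.origin_mem t₀ ht₀)) _ w).trans ?_
      have := hR t₀ ht₀
      gcongr
    have hG2 : q⁻¹ / 2 * ‖fullGrad (suppFn (Ω t₀)) x₀‖ ^ 2 ≤ 2 * (S * q) := by
      have h1 : ‖fullGrad (suppFn (Ω t₀)) x₀‖ ^ 2 ≤ (2 * R₀) ^ 2 :=
        pow_le_pow_left₀ (norm_nonneg _) hG 2
      calc q⁻¹ / 2 * ‖fullGrad (suppFn (Ω t₀)) x₀‖ ^ 2 ≤ q⁻¹ / 2 * (2 * R₀) ^ 2 :=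
            mul_le_mul_of_nonneg_left h1 (by positivity)
        _ = 2 * (q⁻¹ * R₀ ^ 2) := by ring
        _ ≤ _ := by linarith
    have h7 : 0 ≤ M₂ * (S * q) := by positivity
    unfold testFn
    rw [add_mul, hM₁, add_mul]
    linarith

/-! ### From bounded principal radii to the inner radius -/

/-- A longest chord is at least as long as the outer radius, and `hR` makes it no longer than 4M, as
the midpoint lemma requires. The Hessian bound is used only on lines tangent to the unit sphere,
where the norm is at least 1. -/
lemma innerRadius_ge_of_hessForm_le {Ω : ConvexBody (Eu m)} (hΩ : ContDiffOn ℝ ∞ (supp Ω) {0}ᶜ)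
    {M : ℝ} (hM : 0 < M) (hR : outerRadius Ω ≤ 2 * M)
    (h : ∀ y w : Eu m, 1 ≤ ‖y‖ → dd w (dd w (supp Ω)) y ≤ M * ‖w‖ ^ 2) :
    outerRadius Ω ^ 2 / (16 * M) ≤ innerRadius Ω := by
  obtain ⟨p, hp, q, hq, hpq⟩ := exists_outerRadius_le_dist Ω
  have hline : ∀ u w : Eu m, ‖u‖ = 1 → ⟪u, w⟫_ℝ = 0 → ∀ s : ℝ, 1 ≤ ‖u + s • w‖ := by
    intro u w hu huw s
    have h1 := real_inner_le_norm u (u + s • w)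
    rw [inner_add_right, inner_smul_right, huw, real_inner_self_eq_norm_sq, hu] at h1
    simpa using h1
  have hsub := closedBall_midpoint_subset Ω hM hp hq
    (by linarith [dist_le_two_mul_outerRadius Ω hp hq]) (fun u w hu huw => by
      refine second_difference_le isOpen_compl_singleton hΩ (fun s => ?_)
        fun s => h _ _ (hline u w hu huw s)
      have := hline u w hu huw s
      exact norm_pos_iff.1 (by linarith))
  refine le_trans ?_ (le_innerRadius Ω (by positivity) hsub)
  have := outerRadius_nonneg Ω
  gcongr

lemma IsFlow.dd_dd_supp_le {K : ConvexBody (Eu m)} {Ω : ℝ → ConvexBody (Eu m)}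
    (hΩ : IsFlow k f K Ω) {t : ℝ} (ht : 0 < t) {M : ℝ}
    (h : ∀ (x : Sph m) (ξ : Eu m), ‖ξ‖ = 1 → hessForm (suppFn (Ω t)) x ξ ≤ M) {y : Eu m}
    (hy : 1 ≤ ‖y‖) (w : Eu m) : dd w (dd w (supp (Ω t))) y ≤ M * ‖w‖ ^ 2 := by
  have hy0 : y ≠ 0 := norm_pos_iff.1 (by linarith)
  rcases eq_or_ne w 0 with rfl | hw
  · simp [dd]
  have hwn : ‖w‖ ≠ 0 := norm_ne_zero_iff.2 hw
  set ξ : Eu m := ‖w‖⁻¹ • w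
  have hξ : ‖ξ‖ = 1 := by rw [norm_smul, norm_inv, norm_norm, inv_mul_cancel₀ hwn]
  have hwξ : w = ‖w‖ • ξ + (0 : ℝ) • y := by
    rw [smul_smul, mul_inv_cancel₀ hwn]; simp
  rw [← hΩ.dd_dd_space hy0 ht]
  conv_lhs => rw [hwξ]
  rw [dd_dd_add_radial hΩ.contDiffOn (isHom_stSupp Ω) hy0 ht, hΩ.dd_dd_eq hy0 ht, mul_comm]
  refine mul_le_mul_of_nonneg_right ?_ (sq_nonneg _)
  exact (mul_le_of_le_one_left (hΩ.hessForm_nonneg ht _ ξ) (inv_le_one_of_one_le₀ hy)).trans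
    (h _ ξ hξ)

lemma exists_innerRadius_bound (hk : k + 1 ≤ m) (hf : ContMDiff (𝓡 m) 𝓘(ℝ, ℝ) ∞ f)
    (hfpos : ∀ x, 0 < f x) {Ω₀ : ConvexBody (Eu m)}
    (hΩ₀ : ContMDiff (𝓡 m) 𝓘(ℝ, ℝ) ∞ (suppFn Ω₀))
    (h0 : (0 : Eu m) ∈ interior (Ω₀ : Set (Eu m))) :
    ∃ C : ℝ, 0 < C ∧ ∀ θ : ℝ, 0 < θ → ∀ Ω : ℝ → ConvexBody (Eu m),
      IsFlow (k + 1) f (θ • Ω₀) Ω → ∀ R₀ : ℝ, (∀ t, 0 < t → outerRadius (Ω t) ≤ R₀) →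
      ∀ t, 0 < t →
        outerRadius (Ω t) ^ 2 / (C * (1 + R₀) ^ (3 / 2 : ℝ)) ≤ innerRadius (Ω t) := by
  obtain ⟨M, hM, hbound⟩ := exists_hessForm_bound hk hf hfpos hΩ₀ h0
  refine ⟨16 * M, by linarith, fun θ hθ Ω hΩ R₀ hR t ht => ?_⟩
  have hR0 : 0 ≤ R₀ := (outerRadius_nonneg _).trans (hR t ht)
  have hpow : (1 + R₀) ^ (3 / 2 : ℝ) = (1 + R₀) * Real.sqrt (1 + R₀) := by
    rw [show (3 / 2 : ℝ) = 1 + 1 / 2 by norm_num, Real.rpow_add (by linarith), Real.rpow_one,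
      Real.sqrt_eq_rpow]
  rw [hpow, mul_assoc]
  set S := (1 + R₀) * Real.sqrt (1 + R₀)
  have hS : 1 + R₀ ≤ S := by
    have : 1 ≤ Real.sqrt (1 + R₀) := Real.one_le_sqrt.2 (by linarith)
    exact le_mul_of_one_le_right (by linarith) this
  have hMS : S ≤ M * S := le_mul_of_one_le_left (by linarith) hM
  refine innerRadius_ge_of_hessForm_le (hΩ.contDiffOn_slice ht) (by linarith)
    (by linarith [hR t ht]) fun y w hy => ?_
  exact hΩ.dd_dd_supp_le ht (hbound θ hθ Ω hΩ R₀ hR t ht) hy w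

end LogFlow

end

theorem lemma4p5 (m k : ℕ) (hk : 1 ≤ k) (hkm : k ≤ m)
    (f : LogFlow.Sph m → ℝ) (hf : ContMDiff (𝓡 m) 𝓘(ℝ, ℝ) ∞ f) (hfpos : ∀ x, 0 < f x)
    (Ω₀ : ConvexBody (LogFlow.Eu m)) (hΩ₀ : LogFlow.SmoothStrictlyConvex Ω₀)
    (hΩ₀0 : (0 : LogFlow.Eu m) ∈ interior (Ω₀ : Set (LogFlow.Eu m))) :
    ∃ C : ℝ, 0 < C ∧ ∀ θ : ℝ, 0 < θ → ∀ Ω : ℝ → ConvexBody (LogFlow.Eu m),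
      LogFlow.IsFlow k f (θ • Ω₀) Ω → ∀ t : ℝ, 0 < t →
        ENNReal.ofReal (LogFlow.outerRadius (Ω t)) ^ 2 /
            (ENNReal.ofReal C * (1 + LogFlow.supOuterRadius Ω) ^ (3 / 2 : ℝ))
          ≤ ENNReal.ofReal (LogFlow.innerRadius (Ω t)) := by
  obtain ⟨k, rfl⟩ : ∃ k', k = k' + 1 := ⟨k - 1, by omega⟩
  obtain ⟨C, hC, h⟩ := LogFlow.exists_innerRadius_bound hkm hf hfpos hΩ₀.1 hΩ₀0
  refine ⟨C, hC, fun θ hθ Ω hΩ t ht => ?_⟩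
  have hCpos : ENNReal.ofReal C ≠ 0 := by simpa using hC
  rcases eq_or_ne (LogFlow.supOuterRadius Ω) ⊤ with htop | htop
  -- For infinite R₀ the denominator is ⊤, since `C` is nonzero, and the quotient is 0.
  · rw [htop, add_top, ENNReal.top_rpow_of_pos (by norm_num), ENNReal.mul_top hCpos,
      ENNReal.div_top]
    exact zero_le
  set R₀ := (LogFlow.supOuterRadius Ω).toReal with hR₀
  have hR0 : 0 ≤ R₀ := ENNReal.toReal_nonneg
  have hR : ∀ t, 0 < t → LogFlow.outerRadius (Ω t) ≤ R₀ := by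
    intro t ht
    rw [hR₀, ← ENNReal.ofReal_le_iff_le_toReal htop]
    exact le_iSup₂ (f := fun t (_ : t ∈ Ioi (0 : ℝ)) =>
      ENNReal.ofReal (LogFlow.outerRadius (Ω t))) t ht
  have hreal := h θ hθ Ω hΩ R₀ hR t ht
  rw [← ENNReal.ofReal_toReal htop, ← hR₀, ← ENNReal.ofReal_one,
    ← ENNReal.ofReal_add zero_le_one hR0,
    ENNReal.ofReal_rpow_of_nonneg (by linarith) (by norm_num), ← ENNReal.ofReal_mul hC.le,
    ← ENNReal.ofReal_pow (LogFlow.outerRadius_nonneg _),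
    ← ENNReal.ofReal_div_of_pos (by positivity)]
  exact ENNReal.ofReal_le_ofReal hreal
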